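/- **Setup.** Fix an integer $e>1$. Let $Q_+=\bigoplus_{i\in\mathbb Z/e}\mathbb Z_{\ge0}\,\alpha_i$, write $\mathrm{ht}$ for the sum of coefficients, and put $\alpha(t,h)=\alpha_t+\alpha_{t+1}+\cdots+\alpha_{t+h-1}$ for $t\in\mathbb Z/e$, $h\ge1$. Let $\Phi_+=\{\alpha(t,h)\}$ be the set of positive roots (of affine type $A^{(1)}_{e-1}$); a root is imaginary if $e$ divides its height. Let $\Psi\subset\Phi_+$ be the set of indivisible roots, i.e. those not of the form $m\beta'$ with $m>1$, $\beta'\in\Phi_+$. Every positive integer multiple $\gamma$ of a positive root can be written uniquely as $\gamma=m(\gamma)\psi(\gamma)$ with $m(\gamma)\ge1$ and $\psi(\gamma)\in\Psi$. Fix a convex preorder $\succeq$ on $\Phi_+$: a reflexive, transitive, total relation such that $\beta\succeq\gamma$ and $\beta+\gamma\in\Phi_+$ imply $\beta\succeq\beta+\gamma\succeq\gamma$, and such that ($\beta\succeq\gamma$ and $\gamma\succeq\beta$) holds if and only if $\beta=\gamma$ or both $\beta,\gamma$ are imaginary. Write $\beta\succ\gamma$ if $\beta\succeq\gamma$ and $\gamma\not\succeq\beta$.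 For nodes $u,v\in\mathbb Z\times\mathbb Z$ (row, column) write $u\searrow v$ if $u_1\le v_1$ and $u_2\le v_2$. A skew shape is a finite set $\tau\subset\mathbb Z\times\mathbb Z$ such that $u,w\in\tau$ and $u\searrow v\searrow w$ imply $v\in\tau$. Its content is $\mathrm{cont}(\tau)=\sum_{u\in\tau}\alpha_{\overline{u_2-u_1}}\in Q_+$. A tiling of $\tau$ is a set $\Lambda$ of pairwise disjoint nonempty skew shapes (tiles) with union $\tau$. A $\Lambda$-tableau, or tableau for $\tau$, is an ordering $(\lambda_1,\dots,\lambda_n)$ of the $n=|\Lambda|$ tiles such that $u\in\lambda_i$, $v\in\lambda_j$, $u\searrow v$ imply $i\le j$. A skew shape $\tau$ is semicuspidal if $\mathrm{cont}(\tau)=m\beta$ for some $m\ge1$, $\beta\in\Phi_+$, and for every two-tile tableau $(\lambda_1,\lambda_2)$ for $\tau$, $\mathrm{cont}(\lambda_1)$ is a sum of positive roots $\gamma$ with $\beta\succeq\gamma$ and $\mathrm{cont}(\lambda_2)$ is a sum of positive roots $\nu$ with $\nu\succeq\beta$. It is cuspidal if the same holds with $m=1$ and $\succ$ in place of $\succeq$.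 A tiling $\Lambda$ is Kostant (resp. strict Kostant) if it has a tableau $(\lambda_1,\dots,\lambda_n)$ with $\mathrm{cont}(\lambda_i)=m_i\beta_i$, $m_i\ge1$, $\beta_i\in\Phi_+$ and $\beta_1\succeq\cdots\succeq\beta_n$ (resp. $\beta_1\succ\cdots\succ\beta_n$). It is a cuspidal (resp. semicuspidal) tiling if all its tiles are. For a Kostant tiling $\Lambda$, its Kostant partition $\boldsymbol\kappa^\Lambda=(\kappa^\Lambda_\nu)_{\nu\in\Psi}$ is given by $\kappa^\Lambda_\nu=\sum_{\lambda\in\Lambda,\ \psi(\mathrm{cont}(\lambda))=\nu}m(\mathrm{cont}(\lambda))$. **Theorem.** Let $\tau$ be a nonempty skew shape. Then $\tau$ has a unique cuspidal Kostant tiling $\Gamma_\tau$ and a unique semicuspidal strict Kostant tiling $\Gamma^{sc}_\tau$. The latter is obtained by merging the tiles of $\Gamma_\tau$ of equal content: $$\Gamma^{sc}_\tau=\Big\{\bigsqcup_{\gamma\in\Gamma_\tau,\ \mathrm{cont}(\gamma)=\beta}\gamma\ \Big|\ \beta\in\Psi,\ \kappa^{\Gamma_\tau}_\beta>0\Big\},$$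 and $\boldsymbol\kappa^{\Gamma^{sc}_\tau}=\boldsymbol\kappa^{\Gamma_\tau}$. -/

import Mathlib

noncomputable section

namespace SkewTiling

/-! ### Positive roots of affine type `A`, with simple roots indexed by `ZMod e` -/

/-- The positive cone `Q₊` of the root lattice: the coefficient of `α_i` in `θ` is `θ i`. -/
abbrev RootCone (e : ℕ) : Type := ZMod e →₀ ℕ

/-- The simple root `α_i`. -/
def simpleRoot {e : ℕ} (i : ZMod e) : RootCone e := Finsupp.single i 1

/-- The height of an element of `Q₊`: the sum of its coefficients. -/
def height {e : ℕ} (θ : RootCone e) : ℕ := θ.sum fun _ c => c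

/-- `α(t, h) = α_t + α_{t+1} + ⋯ + α_{t+h-1}`. -/
def alpha {e : ℕ} (t : ZMod e) (h : ℕ) : RootCone e :=
  ∑ i ∈ Finset.range h, simpleRoot (t + (i : ZMod e))

def IsPosRoot {e : ℕ} (β : RootCone e) : Prop :=
  ∃ (t : ZMod e) (h : ℕ), 0 < h ∧ β = alpha t h

/-- The set `Φ₊` of positive roots. -/
abbrev PosRoot (e : ℕ) : Type := {β : RootCone e // IsPosRoot β}

/-- A positive root is imaginary when its height is divisible by `e`. -/
def IsImaginary {e : ℕ} (β : PosRoot e) : Prop := e ∣ height β.1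

/-- A positive root which is not a proper multiple of a positive root. -/
def IsIndivisible {e : ℕ} (β : RootCone e) : Prop :=
  IsPosRoot β ∧ ¬ ∃ (m : ℕ) (β' : RootCone e), 1 < m ∧ IsPosRoot β' ∧ β = m • β'

/-- The set `Ψ` of indivisible positive roots. -/
abbrev IndivRoot (e : ℕ) : Type := {β : RootCone e // IsIndivisible β}

/-- `γ = n • β` for some indivisible root `β` and some `n ≥ 1`. -/
def IsRootMultiple {e : ℕ} (γ : RootCone e) : Prop :=
  ∃ (n : ℕ) (β : RootCone e), 0 < n ∧ IsIndivisible β ∧ γ = n • β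

open scoped Classical in
/-- The number `m(γ)` in the decomposition `γ = m(γ) • ψ(γ)` with `ψ(γ)` an indivisible root
(and `0` if there is no such decomposition); see `rootMult_smul` and `psi_smul`. -/
def rootMult {e : ℕ} (γ : RootCone e) : ℕ :=
  if h : IsRootMultiple γ then h.choose else 0

open scoped Classical in
/-- The indivisible root `ψ(γ)` in the decomposition `γ = m(γ) • ψ(γ)`
(and `0` if there is no such decomposition). -/
def psi {e : ℕ} (γ : RootCone e) : RootCone e :=
  if h : IsRootMultiple γ then h.choose_spec.choose else 0

/-! Well-definedness of `m` and `ψ`. -/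

theorem alpha_add {e : ℕ} (t : ZMod e) (h k : ℕ) :
    alpha t (h + k) = alpha t h + alpha (t + (h : ZMod e)) k := by
  simp only [alpha, Finset.sum_range_add, Nat.cast_add, add_assoc]

theorem alpha_mul {e : ℕ} (t : ZMod e) (q : ℕ) : alpha t (e * q) = q • alpha t e := by
  induction q with
  | zero => simp [alpha]
  | succ q ih => rw [Nat.mul_succ, alpha_add, ih, succ_nsmul]; simp

theorem height_add {e : ℕ} (a b : RootCone e) : height (a + b) = height a + height b :=
  Finsupp.sum_add_index' (fun _ => rfl) (fun _ _ _ => rfl)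

theorem height_smul {e : ℕ} (n : ℕ) (a : RootCone e) : height (n • a) = n * height a := by
  induction n with
  | zero => simp [height]
  | succ n ih => rw [succ_nsmul, height_add, ih]; ring

theorem height_alpha {e : ℕ} (t : ZMod e) (h : ℕ) : height (alpha t h) = h := by
  induction h with
  | zero => simp [alpha, height]
  | succ h ih => rw [alpha_add, height_add, ih]; simp [alpha, height, simpleRoot]

open scoped Classical in
theorem alpha_apply_shift {e : ℕ} (t s : ZMod e) (h : ℕ) :
    alpha t h (s + 1) + (if s + 1 = t + h then 1 else 0)
      = alpha t h s + (if s + 1 = t then 1 else 0) := by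
  induction h with
  | zero => simp [alpha]
  | succ h ih =>
    have h1 : ∀ x, alpha t (h + 1) x = alpha t h x + (if x = t + h then 1 else 0) := by
      intro x
      rw [alpha_add]
      simp [alpha, simpleRoot, Finsupp.single_apply, eq_comm]
    have h2 : (s + 1 = t + ((h + 1 : ℕ) : ZMod e)) ↔ s = t + h := by
      push_cast
      rw [← add_assoc, add_left_inj]
    rw [h1, h1]
    simp only [h2]
    omega

theorem eq_one_of_dvd_indivisible {e : ℕ} (he : 1 < e) {β : RootCone e} (hβ : IsIndivisible β)
    {d : ℕ} (hd : ∀ s, d ∣ β s) : d = 1 := by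
  obtain ⟨⟨t, h, h0, rfl⟩, hi⟩ := hβ
  have : NeZero e := ⟨by omega⟩
  by_cases hh : (h : ZMod e) = 0
  · obtain ⟨q, rfl⟩ := (ZMod.natCast_eq_zero_iff h e).1 hh
    have hq : q = 1 := by
      by_contra hq
      refine hi ⟨q, alpha t e, ?_, ⟨t, e, by omega, rfl⟩, alpha_mul t q⟩
      rcases q with _ | _ | q <;> simp_all
    subst hq
    have h1 : alpha t (e * 1) t = 1 := by
      rw [mul_one]
      simp only [alpha, simpleRoot, Finsupp.finsetSum_apply]
      rw [Finset.sum_eq_single 0]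
      · simp
      · intro b hb hb0
        rw [Finsupp.single_apply, if_neg]
        intro hc
        have : (b : ZMod e) = 0 := by simpa using hc
        have := Nat.le_of_dvd (by omega) ((ZMod.natCast_eq_zero_iff b e).1 this)
        have := Finset.mem_range.1 hb
        omega
      · intro hc; simp at hc; omega
    have := hd t
    rw [h1] at this
    exact Nat.dvd_one.1 this
  · have key := alpha_apply_shift t (t - 1) h
    have hne : ¬ (t = t + (h : ZMod e)) := by simpa using hh
    rw [sub_add_cancel, if_neg hne, if_pos rfl, add_zero] at key
    have h1 := hd t
    rw [key] at h1
    exact Nat.dvd_one.1 ((Nat.dvd_add_right (hd (t - 1))).1 h1)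

theorem smul_indivisible_inj {e : ℕ} (he : 1 < e) {n n' : ℕ} {β β' : RootCone e} (hn : 0 < n)
    (hn' : 0 < n') (hβ : IsIndivisible β) (hβ' : IsIndivisible β') (h : n • β = n' • β') :
    n = n' ∧ β = β' := by
  have aux : ∀ {a b : ℕ} {x y : RootCone e}, 0 < a → IsIndivisible y → a • x = b • y → a ∣ b := by
    intro a b x y ha hy hxy
    have hs : ∀ s, a * x s = b * y s := fun s => by simpa using DFunLike.congr_fun hxy s
    obtain ⟨g, a', b', hg, hco, rfl, rfl⟩ := Nat.exists_coprime' (Nat.gcd_pos_of_pos_left b ha)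
    have ha1 : a' = 1 := by
      refine eq_one_of_dvd_indivisible he hy fun s => hco.dvd_of_dvd_mul_left ?_
      refine ⟨x s, ?_⟩
      have := hs s
      have h' : g * (b' * y s) = g * (a' * x s) := by linarith
      exact Nat.eq_of_mul_eq_mul_left hg h'
    subst ha1
    exact ⟨b', by ring⟩
  have hnn : n = n' := Nat.dvd_antisymm (aux hn hβ' h) (aux hn' hβ h.symm)
  subst hnn
  refine ⟨rfl, ?_⟩
  ext s
  have : n * β s = n * β' s := by simpa using DFunLike.congr_fun h s
  exact Nat.eq_of_mul_eq_mul_left hn this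

theorem rootMult_psi_smul {e : ℕ} (he : 1 < e) {n : ℕ} {β : RootCone e} (hn : 0 < n)
    (hβ : IsIndivisible β) : rootMult (n • β) = n ∧ psi (n • β) = β := by
  have h : IsRootMultiple (n • β) := ⟨n, β, hn, hβ, rfl⟩
  obtain ⟨h1, h2, h3⟩ := h.choose_spec.choose_spec
  have := smul_indivisible_inj he hn h1 hβ h2 h3
  rw [rootMult, psi, dif_pos h, dif_pos h]
  exact ⟨this.1.symm, this.2.symm⟩

theorem rootMult_smul {e : ℕ} (he : 1 < e) {n : ℕ} {β : RootCone e} (hn : 0 < n)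
    (hβ : IsIndivisible β) : rootMult (n • β) = n :=
  (rootMult_psi_smul he hn hβ).1

theorem psi_smul {e : ℕ} (he : 1 < e) {n : ℕ} {β : RootCone e} (hn : 0 < n)
    (hβ : IsIndivisible β) : psi (n • β) = β :=
  (rootMult_psi_smul he hn hβ).2

theorem IsPosRoot.isRootMultiple {e : ℕ} {β : RootCone e} (hβ : IsPosRoot β) :
    IsRootMultiple β := by
  induction hk : height β using Nat.strong_induction_on generalizing β with
  | _ k ih =>
    by_cases hi : IsIndivisible β
    · exact ⟨1, β, one_pos, hi, (one_smul _ _).symm⟩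
    · obtain ⟨m, β', hm, hβ', rfl⟩ : ∃ (m : ℕ) (β' : RootCone e),
          1 < m ∧ IsPosRoot β' ∧ β = m • β' := by
        by_contra hc
        exact hi ⟨hβ, hc⟩
      have hpos : 0 < height β' := by
        obtain ⟨t, h, h0, rfl⟩ := hβ'
        rwa [height_alpha]
      have hlt : height β' < k := by
        rw [← hk, height_smul]
        nlinarith
      obtain ⟨n, b, hn, hb, rfl⟩ := ih _ hlt hβ' rfl
      exact ⟨m * n, b, by positivity, hb, by rw [mul_smul]⟩

theorem IsPosRoot.smul_isRootMultiple {e n : ℕ} {β : RootCone e} (hβ : IsPosRoot β) (hn : 0 < n) :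
    IsRootMultiple (n • β) := by
  obtain ⟨m, b, hm, hb, rfl⟩ := hβ.isRootMultiple
  exact ⟨n * m, b, by positivity, hb, by rw [mul_smul]⟩

/-- A convex preorder on the set of positive roots; `ge β γ` is `β ⪰ γ`. -/
structure ConvexPreorder (e : ℕ) where
  ge : PosRoot e → PosRoot e → Prop
  refl : ∀ β, ge β β
  trans : ∀ β γ ν, ge β γ → ge γ ν → ge β ν
  total : ∀ β γ, ge β γ ∨ ge γ β
  convex : ∀ β γ σ : PosRoot e, σ.1 = β.1 + γ.1 → ge β γ → ge β σ ∧ ge σ γ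
  imaginary_equiv : ∀ β γ, (ge β γ ∧ ge γ β) ↔ (β = γ ∨ (IsImaginary β ∧ IsImaginary γ))

/-- The strict relation `β ≻ γ`. -/
def ConvexPreorder.gt {e : ℕ} (P : ConvexPreorder e) (β γ : PosRoot e) : Prop :=
  P.ge β γ ∧ ¬ P.ge γ β

/-! ### Skew shapes, tilings and tableaux -/

/-- The node `(i, j)` is the box in row `i` (growing southwards) and column `j` (growing eastwards).
The product order `u ≤ v` says that `v` is weakly southeast of `u`. -/
abbrev Node : Type := ℤ × ℤ

def IsSkewShape (τ : Finset Node) : Prop :=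
  ∀ u ∈ τ, ∀ w ∈ τ, ∀ v : Node, u ≤ v → v ≤ w → v ∈ τ

/-- The residue of a node. -/
def res (e : ℕ) (u : Node) : ZMod e := ((u.2 - u.1 : ℤ) : ZMod e)

/-- The content of a shape. -/
def content (e : ℕ) (τ : Finset Node) : RootCone e := ∑ u ∈ τ, simpleRoot (res e u)

/-- `Λ` is a set of pairwise disjoint nonempty skew shapes with union `τ`. -/
structure IsTiling (τ : Finset Node) (Λ : Finset (Finset Node)) : Prop where
  nonempty : ∀ μ ∈ Λ, μ.Nonempty
  skew : ∀ μ ∈ Λ, IsSkewShape μ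
  disjoint : ∀ μ ∈ Λ, ∀ ν ∈ Λ, μ ≠ ν → Disjoint μ ν
  union : Λ.biUnion id = τ

/-- `(Λ, t)` is a tableau for `τ`: `Λ` is a tiling of `τ`, and `t` enumerates the tiles of `Λ`
without repetition (so that `n = |Λ|`), in such a way that if a node of `t i` lies weakly northwest
of a node of `t j`, then `i ≤ j`. -/
structure IsTableau (τ : Finset Node) (Λ : Finset (Finset Node)) {n : ℕ}
    (t : Fin n → Finset Node) : Prop where
  tiling : IsTiling τ Λ
  injective : Function.Injective t
  range_eq : Set.range t = (Λ : Set (Finset Node))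
  order : ∀ i j, ∀ u ∈ t i, ∀ v ∈ t j, u ≤ v → i ≤ j

/-- The tile sequence `(μ₁, μ₂)` is a tableau for `τ`. -/
def IsTwoTableau (τ μ₁ μ₂ : Finset Node) : Prop := IsTableau τ {μ₁, μ₂} ![μ₁, μ₂]

/-- `θ` is a sum of positive roots all of which satisfy `p`. -/
def IsSumOfRoots {e : ℕ} (p : PosRoot e → Prop) (θ : RootCone e) : Prop :=
  ∃ l : List (PosRoot e), (∀ γ ∈ l, p γ) ∧ θ = (l.map Subtype.val).sum

/-! ### Cuspidality and Kostant tilings -/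

def IsCuspidal {e : ℕ} (P : ConvexPreorder e) (τ : Finset Node) : Prop :=
  IsSkewShape τ ∧ ∃ β : PosRoot e, content e τ = β.1 ∧
    ∀ μ₁ μ₂ : Finset Node, IsTwoTableau τ μ₁ μ₂ →
      IsSumOfRoots (fun γ => P.gt β γ) (content e μ₁) ∧
      IsSumOfRoots (fun γ => P.gt γ β) (content e μ₂)

def IsSemicuspidal {e : ℕ} (P : ConvexPreorder e) (τ : Finset Node) : Prop :=
  IsSkewShape τ ∧ ∃ (m : ℕ) (β : PosRoot e), 0 < m ∧ content e τ = m • β.1 ∧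
    ∀ μ₁ μ₂ : Finset Node, IsTwoTableau τ μ₁ μ₂ →
      IsSumOfRoots (fun γ => P.ge β γ) (content e μ₁) ∧
      IsSumOfRoots (fun γ => P.ge γ β) (content e μ₂)

/-- `Λ` has a tableau `t` such that the content of `t i` is `m_i • β_i` with `m_i ≥ 1` and
`β_1 ⪰ β_2 ⪰ ⋯`. -/
def IsKostantTiling {e : ℕ} (P : ConvexPreorder e) (τ : Finset Node)
    (Λ : Finset (Finset Node)) : Prop :=
  ∃ (n : ℕ) (t : Fin n → Finset Node) (m : Fin n → ℕ) (β : Fin n → PosRoot e),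
    IsTableau τ Λ t ∧ (∀ i, 0 < m i ∧ content e (t i) = m i • (β i).1) ∧
    ∀ i j, i < j → P.ge (β i) (β j)

/-- `Λ` has a tableau `t` such that the content of `t i` is `m_i • β_i` with `m_i ≥ 1` and
`β_1 ≻ β_2 ≻ ⋯`. -/
def IsStrictKostantTiling {e : ℕ} (P : ConvexPreorder e) (τ : Finset Node)
    (Λ : Finset (Finset Node)) : Prop :=
  ∃ (n : ℕ) (t : Fin n → Finset Node) (m : Fin n → ℕ) (β : Fin n → PosRoot e),
    IsTableau τ Λ t ∧ (∀ i, 0 < m i ∧ content e (t i) = m i • (β i).1) ∧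
    ∀ i j, i < j → P.gt (β i) (β j)

def IsCuspidalKostantTiling {e : ℕ} (P : ConvexPreorder e) (τ : Finset Node)
    (Λ : Finset (Finset Node)) : Prop :=
  IsKostantTiling P τ Λ ∧ ∀ μ ∈ Λ, IsCuspidal P μ

def IsSemicuspidalStrictKostantTiling {e : ℕ} (P : ConvexPreorder e) (τ : Finset Node)
    (Λ : Finset (Finset Node)) : Prop :=
  IsStrictKostantTiling P τ Λ ∧ ∀ μ ∈ Λ, IsSemicuspidal P μ

open scoped Classical in
/-- The Kostant partition `κ^Λ = (κ_ν)_{ν ∈ Ψ}` of a Kostant tiling: `κ_ν` is the sum of the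
multiplicities `m(cont λ)` over the tiles `λ` with `ψ(cont λ) = ν`. -/
def kostantPartition (e : ℕ) (Λ : Finset (Finset Node)) (ν : IndivRoot e) : ℕ :=
  ∑ μ ∈ Λ with psi (content e μ) = ν.1, rootMult (content e μ)

open scoped Classical in
/-- The shapes obtained by merging all tiles of content `β`, for the `β ∈ Ψ` with `κ_β > 0`. -/
def mergedTiles (e : ℕ) (Γ : Finset (Finset Node)) : Set (Finset Node) :=
  {μ | ∃ β : IndivRoot e, 0 < kostantPartition e Γ β ∧
    μ = (Γ.filter fun γ => content e γ = β.1).biUnion id}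

end SkewTiling

end

noncomputable section

namespace SkewTiling

variable {e : ℕ}

/-! ### Sums of roots on the two sides of a biconvex set -/

/-! This is Harder–Narasimhan and Jordan–Hölder theory for skew shapes. Fix a root β. By convexity,
comparing the roots α_n + ⋯ + α_{m-1} with β defines a total preorder on ℤ; since ℤ is countable, it
is induced by a function p : ℤ → ℚ (`potential`). A node on diagonal d gets weight p(d+1) - p(d).
Weights add over disjoint unions, and a ribbon with diagonals n, …, m-1 has weight p(m) - p(n),
whose sign compares its content with β.

Ribbons suffice: a shape in which no proper nonempty ideal has the weight of a proper nonempty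
filter is a ribbon (`exists_isRibbon`), so an ideal minimal for a sign condition on weights is a
ribbon (`exists_low_isRibbon`). Moreover, a nonzero element of Q₊ is never both a sum of roots ≻ β
and a sum of roots ⪯ β (`eq_zero_of_isSumOfRoots`). Together these identify semicuspidal with
semistable and cuspidal with stable; the root β, up to equivalence, is the slope.

Existence: for β greatest among the contents of ribbon ideals, no ideal has positive weight.
Splitting off a minimal (for cuspidal tiles) or a largest (for semicuspidal tiles) nonempty ideal of
weight zero, and repeating, gives the tilings.

Uniqueness: an ideal of maximal weight for b contains every tile of slope ≻ b and misses every tile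
of slope ≺ b. Such ideals depend only on the whole shape, so the slope at a node is the same for all
tableaux (`SemistableTableau.ge_of_mem`). They never split a stable tile, which therefore lies in a
single tile of any other tableau (`SemistableTableau.exists_subset`). The nodes of a given slope
form a set independent of the tableau; its content is κ_ν ν, which gives the merging statement and
the equality of Kostant partitions. -/

theorem height_pos {β : RootCone e} (hβ : IsPosRoot β) : 0 < height β := by
  obtain ⟨t, h, h0, rfl⟩ := hβ
  rwa [height_alpha]

/-- The arc of length `x.2` from `x.1` to `x.1 + x.2` in the cyclic quiver, as a root. -/
def arcRoot (x : ZMod e × ℕ) : RootCone e := alpha x.1 x.2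

theorem arcRoot_add (t : ZMod e) (h k : ℕ) :
    arcRoot (t, h + k) = arcRoot (t, h) + arcRoot (t + (h : ZMod e), k) :=
  alpha_add t h k

open scoped Classical in
-- The coefficients of one arc jump up by one at its start and down by one just past its end; for a
-- sum of arcs the jumps count starts minus ends.
theorem sum_arcRoot_apply_shift (X : Multiset (ZMod e × ℕ)) (s : ZMod e) :
    (X.map arcRoot).sum (s + 1) + X.countP (fun x => s + 1 = x.1 + x.2)
      = (X.map arcRoot).sum s + X.countP (fun x => s + 1 = x.1) := by
  induction X using Multiset.induction with
  | empty => simp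
  | cons x X ih =>
    have : arcRoot x (s + 1) + (if s + 1 = x.1 + x.2 then 1 else 0)
        = arcRoot x s + (if s + 1 = x.1 then 1 else 0) := alpha_apply_shift x.1 s x.2
    simp only [Multiset.map_cons, Multiset.sum_cons, Finsupp.add_apply, Multiset.countP_cons]
    omega

theorem height_sum_arcRoot_cons_pos {x : ZMod e × ℕ} (hx : 0 < x.2) (X : Multiset (ZMod e × ℕ)) :
    0 < height (((x ::ₘ X).map arcRoot).sum) := by
  rw [Multiset.map_cons, Multiset.sum_cons, height_add, arcRoot, height_alpha]
  omega

open scoped Classical in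
-- Induction on the number of arcs. Equal sums force equal counts of starts minus ends at every
-- vertex. So at the end of a non-closed arc of `X`, either another arc of `X` starts, and the two
-- are concatenated, or an arc of `Y` ends, and the shorter is cancelled from the longer. Closure of
-- `U` and of its complement keeps the new arc on its side. Once only closed arcs remain, `him` is
-- contradicted.
theorem eq_zero_of_sum_arcRoot_eq (U : ZMod e × ℕ → Prop)
    (hU : ∀ t h k, 0 < h → 0 < k → U (t, h) → U (t + (h : ZMod e), k) → U (t, h + k))
    (hU' : ∀ t h k, 0 < h → 0 < k → ¬ U (t, h) → ¬ U (t + (h : ZMod e), k) → ¬ U (t, h + k))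
    (him : ∀ x y : ZMod e × ℕ, 0 < x.2 → 0 < y.2 → (x.2 : ZMod e) = 0 → (y.2 : ZMod e) = 0 →
      U x → U y)
    (X Y : Multiset (ZMod e × ℕ)) (hX : ∀ x ∈ X, 0 < x.2 ∧ U x) (hY : ∀ y ∈ Y, 0 < y.2 ∧ ¬ U y)
    (hXY : (X.map arcRoot).sum = (Y.map arcRoot).sum) : X = 0 := by
  induction hn : X.card + Y.card using Nat.strong_induction_on generalizing X Y with
  | _ n ih =>
  have bal (v : ZMod e) : X.countP (fun x => v = x.1 + x.2) + Y.countP (fun x => v = x.1)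
      = Y.countP (fun x => v = x.1 + x.2) + X.countP (fun x => v = x.1) := by
    have h1 := sum_arcRoot_apply_shift X (v - 1)
    have h2 := sum_arcRoot_apply_shift Y (v - 1)
    rw [hXY] at h1
    simp only [sub_add_cancel] at h1 h2
    omega
  by_cases hXi : ∃ x ∈ X, (x.2 : ZMod e) ≠ 0
  · exfalso
    obtain ⟨⟨t, h⟩, hx, hxi⟩ := hXi
    obtain ⟨X', rfl⟩ := Multiset.exists_cons_of_mem hx
    obtain ⟨h0, hUx⟩ := hX _ hx
    have b := bal (t + h)
    rw [Multiset.countP_cons, Multiset.countP_cons, if_pos rfl, if_neg (by simpa using hxi)] at b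
    have hor : 0 < Y.countP (fun x => t + (h : ZMod e) = x.1 + x.2)
        ∨ 0 < X'.countP (fun x => t + (h : ZMod e) = x.1) := by omega
    have hX' : ∀ x ∈ X', 0 < x.2 ∧ U x := fun x hx => hX x (Multiset.mem_cons_of_mem hx)
    rcases hor with hor | hor
    · obtain ⟨⟨s, k⟩, hy, hs⟩ := Multiset.countP_pos.1 hor
      obtain ⟨Y', rfl⟩ := Multiset.exists_cons_of_mem hy
      obtain ⟨k0, hUy⟩ := hY _ hy
      have hY' : ∀ x ∈ Y', 0 < x.2 ∧ ¬ U x := fun x hx => hY x (Multiset.mem_cons_of_mem hx)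
      simp only [Multiset.map_cons, Multiset.sum_cons, Multiset.card_cons] at hXY hs hn h0 k0
      rcases lt_trichotomy h k with hlt | rfl | hlt
      · obtain ⟨d, rfl⟩ := Nat.exists_eq_add_of_le' hlt.le
        have ht : t = s + (d : ZMod e) := by
          push_cast at hs
          rw [← add_assoc] at hs
          exact add_right_cancel hs
        subst ht
        have hd : 0 < d := by omega
        have hUd : ¬ U (s, d) := fun hc => hUy (hU s d h hd h0 hc hUx)
        have hs' : (X'.map arcRoot).sum = (((s, d) ::ₘ Y').map arcRoot).sum := by
          rw [Multiset.map_cons, Multiset.sum_cons]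
          rw [arcRoot_add] at hXY
          have : arcRoot (s + (d : ZMod e), h) + (X'.map arcRoot).sum
            = arcRoot (s + (d : ZMod e), h) + (arcRoot (s, d) + (Y'.map arcRoot).sum) := by
            rw [hXY]; abel
          exact add_left_cancel this
        have := ih _ (by rw [Multiset.card_cons]; omega) X' ((s, d) ::ₘ Y') hX'
          (by
            intro y hy
            rcases Multiset.mem_cons.1 hy with rfl | hy
            · exact ⟨hd, hUd⟩
            · exact hY' y hy) hs' rfl
        subst this
        have h3 := height_sum_arcRoot_cons_pos (x := (s, d)) hd Y'
        rw [← hs'] at h3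
        simp [height] at h3
      · have := add_right_cancel hs
        subst this
        exact hUy hUx
      · obtain ⟨d, rfl⟩ := Nat.exists_eq_add_of_le' hlt.le
        have ht : s = t + (d : ZMod e) := by
          push_cast at hs
          rw [← add_assoc] at hs
          exact (add_right_cancel hs).symm
        subst ht
        have hd : 0 < d := by omega
        have hUd : U (t, d) := by
          by_contra hc
          exact hU' t d k hd k0 hc hUy hUx
        have hs' : (((t, d) ::ₘ X').map arcRoot).sum = (Y'.map arcRoot).sum := by
          rw [Multiset.map_cons, Multiset.sum_cons]
          rw [arcRoot_add] at hXY
          have : arcRoot (t + (d : ZMod e), k) + (arcRoot (t, d) + (X'.map arcRoot).sum)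
            = arcRoot (t + (d : ZMod e), k) + (Y'.map arcRoot).sum := by
            rw [← hXY]; abel
          exact add_left_cancel this
        have := ih _ (by rw [Multiset.card_cons]; omega) ((t, d) ::ₘ X') Y'
          (by
            intro y hy
            rcases Multiset.mem_cons.1 hy with rfl | hy
            · exact ⟨hd, hUd⟩
            · exact hX' y hy) hY' hs' rfl
        exact Multiset.cons_ne_zero this
    · obtain ⟨⟨s, k⟩, hy, hs⟩ := Multiset.countP_pos.1 hor
      obtain ⟨X'', rfl⟩ := Multiset.exists_cons_of_mem hy
      obtain ⟨k0, hUy⟩ := hX' _ hy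
      simp only [Multiset.map_cons, Multiset.sum_cons, Multiset.card_cons] at hXY hs hn h0 k0
      subst hs
      have := ih _ (by rw [Multiset.card_cons]; omega) ((t, h + k) ::ₘ X'') Y
          (by
            intro y hy
            rcases Multiset.mem_cons.1 hy with rfl | hy
            · exact ⟨by simp; omega, hU t h k h0 k0 hUx hUy⟩
            · exact hX' y (Multiset.mem_cons_of_mem hy)) hY
          (by rw [← hXY, Multiset.map_cons, Multiset.sum_cons, arcRoot_add, add_assoc]) rfl
      exact Multiset.cons_ne_zero this
  · push Not at hXi
    by_cases hYi : ∃ y ∈ Y, (y.2 : ZMod e) ≠ 0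
    · obtain ⟨⟨t, h⟩, hx, hxi⟩ := hYi
      obtain ⟨Y', rfl⟩ := Multiset.exists_cons_of_mem hx
      obtain ⟨h0, hUx⟩ := hY _ hx
      have hY' : ∀ x ∈ Y', 0 < x.2 ∧ ¬ U x := fun x hx => hY x (Multiset.mem_cons_of_mem hx)
      have b := bal (t + h)
      rw [Multiset.countP_cons, Multiset.countP_cons, if_pos rfl, if_neg (by simpa using hxi)] at b
      -- Closed arcs start and end at the same vertex and drop out of the balance, so the arc
      -- starting at `t + h` must come from `Y`.
      have b' : X.countP (fun x => t + (h : ZMod e) = x.1 + x.2)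
          = X.countP (fun x => t + (h : ZMod e) = x.1) :=
        Multiset.countP_congr rfl fun x hx => by rw [hXi x hx, add_zero]
      obtain ⟨⟨s, k⟩, hy, hs⟩ := Multiset.countP_pos.1
        (show 0 < Y'.countP (fun x => t + (h : ZMod e) = x.1) by omega)
      obtain ⟨Y'', rfl⟩ := Multiset.exists_cons_of_mem hy
      obtain ⟨k0, hUy⟩ := hY' _ hy
      simp only [Multiset.map_cons, Multiset.sum_cons, Multiset.card_cons] at hXY hs hn h0 k0
      subst hs
      exact ih _ (by rw [Multiset.card_cons]; omega) X ((t, h + k) ::ₘ Y'') hX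
          (by
            intro y hy
            rcases Multiset.mem_cons.1 hy with rfl | hy
            · exact ⟨by simp; omega, hU' t h k h0 k0 hUx hUy⟩
            · exact hY' y (Multiset.mem_cons_of_mem hy))
          (by rw [hXY, Multiset.map_cons, Multiset.sum_cons, arcRoot_add, add_assoc]) rfl
    · push Not at hYi
      by_contra hX0
      obtain ⟨x, hx⟩ := Multiset.exists_mem_of_ne_zero hX0
      have hY0 : Y ≠ 0 := by
        rintro rfl
        obtain ⟨X', rfl⟩ := Multiset.exists_cons_of_mem hx
        have h3 := height_sum_arcRoot_cons_pos (hX x hx).1 X'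
        rw [hXY] at h3
        simp [height] at h3
      obtain ⟨y, hy⟩ := Multiset.exists_mem_of_ne_zero hY0
      exact (hY y hy).2 (him x y (hX x hx).1 (hY y hy).1 (hXi x hx) (hYi y hy) (hX x hx).2)

theorem IsSumOfRoots.mono {p q : PosRoot e → Prop} {θ : RootCone e} (h : IsSumOfRoots p θ)
    (hpq : ∀ γ, p γ → q γ) : IsSumOfRoots q θ := by
  obtain ⟨l, hl, rfl⟩ := h
  exact ⟨l, fun γ hγ => hpq γ (hl γ hγ), rfl⟩

theorem IsSumOfRoots.exists_arcs {p : PosRoot e → Prop} {θ : RootCone e} (h : IsSumOfRoots p θ) :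
    ∃ X : Multiset (ZMod e × ℕ), (∀ x ∈ X, 0 < x.2 ∧ ∀ γ : PosRoot e, γ.1 = arcRoot x → p γ) ∧
      θ = (X.map arcRoot).sum := by
  obtain ⟨l, hl, rfl⟩ := h
  induction l with
  | nil => exact ⟨0, by simp, by simp⟩
  | cons γ l ih =>
    obtain ⟨X, hX, hs⟩ := ih fun γ' h => hl γ' (List.mem_cons_of_mem _ h)
    obtain ⟨t, h, h0, hγ⟩ := γ.2
    change γ.1 = arcRoot (t, h) at hγ
    refine ⟨(t, h) ::ₘ X, ?_, by rw [List.map_cons, List.sum_cons, hs, hγ, Multiset.map_cons, Multiset.sum_cons]⟩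
    intro x hx
    rcases Multiset.mem_cons.1 hx with rfl | hx
    · refine ⟨h0, fun γ' h' => ?_⟩
      have : γ' = γ := Subtype.ext (by rw [h', hγ])
      rw [this]
      exact hl γ (List.mem_cons_self)
    · exact hX x hx

theorem eq_zero_of_isSumOfRoots (U : PosRoot e → Prop)
    (hU : ∀ β γ σ : PosRoot e, σ.1 = β.1 + γ.1 → U β → U γ → U σ)
    (hU' : ∀ β γ σ : PosRoot e, σ.1 = β.1 + γ.1 → ¬ U β → ¬ U γ → ¬ U σ)
    (him : ∀ β γ, IsImaginary β → IsImaginary γ → U β → U γ)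
    {θ : RootCone e} (h : IsSumOfRoots U θ) (h' : IsSumOfRoots (fun γ => ¬ U γ) θ) : θ = 0 := by
  obtain ⟨X, hX, rfl⟩ := h.exists_arcs
  obtain ⟨Y, hY, hXY⟩ := h'.exists_arcs
  have key := eq_zero_of_sum_arcRoot_eq (fun x => ∀ γ : PosRoot e, γ.1 = arcRoot x → U γ)
    ?_ ?_ ?_ X Y hX ?_ hXY
  · rw [key, Multiset.map_zero, Multiset.sum_zero]
  · intro t h k h0 k0 h1 h2 γ hγ
    exact hU ⟨_, t, h, h0, rfl⟩ ⟨_, _, k, k0, rfl⟩ γ (hγ.trans (alpha_add _ _ _)) (h1 _ rfl)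
      (h2 _ rfl)
  · intro t h k h0 k0 h1 h2 h3
    push Not at h1 h2
    obtain ⟨β, hβ, hβ'⟩ := h1
    obtain ⟨γ, hγ, hγ'⟩ := h2
    refine hU' β γ ⟨_, t, h + k, by omega, rfl⟩ ?_ hβ' hγ' (h3 _ rfl)
    rw [hβ, hγ]
    exact alpha_add _ _ _
  · intro x y hx hy hx' hy' h1 γ hγ
    refine him ⟨_, x.1, x.2, hx, rfl⟩ γ ?_ ?_ (h1 _ rfl)
    · rw [IsImaginary, height_alpha]
      exact (ZMod.natCast_eq_zero_iff _ _).1 hx'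
    · rw [IsImaginary, hγ, arcRoot, height_alpha]
      exact (ZMod.natCast_eq_zero_iff _ _).1 hy'
  · intro y hy
    exact ⟨(hY y hy).1, fun h => (hY y hy).2 ⟨_, y.1, y.2, (hY y hy).1, rfl⟩ rfl (h _ rfl)⟩

/-! ### Convex preorders -/

namespace ConvexPreorder

variable (P : ConvexPreorder e)

theorem not_ge {β γ : PosRoot e} : ¬ P.ge β γ ↔ P.gt γ β :=
  ⟨fun h => ⟨(P.total β γ).resolve_left h, h⟩, fun h => h.2⟩

theorem not_gt {β γ : PosRoot e} : ¬ P.gt β γ ↔ P.ge γ β := by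
  rw [← P.not_ge, not_not]

theorem gt_of_gt_of_ge {β γ ν : PosRoot e} (h : P.gt β γ) (h' : P.ge γ ν) : P.gt β ν :=
  ⟨P.trans _ _ _ h.1 h', fun hc => h.2 (P.trans _ _ _ h' hc)⟩

theorem gt_of_ge_of_gt {β γ ν : PosRoot e} (h : P.ge β γ) (h' : P.gt γ ν) : P.gt β ν :=
  ⟨P.trans _ _ _ h h'.1, fun hc => h'.2 (P.trans _ _ _ hc h)⟩

theorem gt_trans {β γ ν : PosRoot e} (h : P.gt β γ) (h' : P.gt γ ν) : P.gt β ν :=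
  P.gt_of_gt_of_ge h h'.1

theorem ge_of_isImaginary {β γ : PosRoot e} (h : IsImaginary β) (h' : IsImaginary γ) : P.ge β γ :=
  ((P.imaginary_equiv β γ).2 (Or.inr ⟨h, h'⟩)).1

theorem add_ge {β γ σ ν : PosRoot e} (hσ : σ.1 = β.1 + γ.1) (h : P.ge β ν) (h' : P.ge γ ν) :
    P.ge σ ν := by
  rcases P.total β γ with h1 | h1
  · exact P.trans _ _ _ (P.convex _ _ _ hσ h1).2 h'
  · exact P.trans _ _ _ (P.convex _ _ _ (hσ.trans (add_comm _ _)) h1).2 h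

theorem ge_add {β γ σ ν : PosRoot e} (hσ : σ.1 = β.1 + γ.1) (h : P.ge ν β) (h' : P.ge ν γ) :
    P.ge ν σ := by
  rcases P.total β γ with h1 | h1
  · exact P.trans _ _ _ h (P.convex _ _ _ hσ h1).1
  · exact P.trans _ _ _ h' (P.convex _ _ _ (hσ.trans (add_comm _ _)) h1).1

theorem add_gt {β γ σ ν : PosRoot e} (hσ : σ.1 = β.1 + γ.1) (h : P.gt β ν) (h' : P.gt γ ν) :
    P.gt σ ν := by
  rcases P.total β γ with h1 | h1
  · exact P.gt_of_ge_of_gt (P.convex _ _ _ hσ h1).2 h'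
  · exact P.gt_of_ge_of_gt (P.convex _ _ _ (hσ.trans (add_comm _ _)) h1).2 h

theorem gt_add {β γ σ ν : PosRoot e} (hσ : σ.1 = β.1 + γ.1) (h : P.gt ν β) (h' : P.gt ν γ) :
    P.gt ν σ := by
  rcases P.total β γ with h1 | h1
  · exact P.gt_of_gt_of_ge h (P.convex _ _ _ hσ h1).1
  · exact P.gt_of_gt_of_ge h' (P.convex _ _ _ (hσ.trans (add_comm _ _)) h1).1

/-- Heights rule out σ = γ, so both are imaginary; then `e` divides the height of β as well. -/
theorem isImaginary_of_add_equiv {β γ σ : PosRoot e} (hσ : σ.1 = β.1 + γ.1) (h : P.ge γ σ)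
    (h' : P.ge σ γ) : P.ge γ β ∧ P.ge β γ := by
  rcases (P.imaginary_equiv γ σ).1 ⟨h, h'⟩ with h1 | ⟨h1, h2⟩
  · have h3 := congrArg height hσ
    rw [height_add, h1] at h3
    have := height_pos β.2
    omega
  · have h3 : IsImaginary β := by
      unfold IsImaginary at *
      rw [hσ, height_add] at h2
      exact (Nat.dvd_add_left h1).1 h2
    exact ⟨P.ge_of_isImaginary h1 h3, P.ge_of_isImaginary h3 h1⟩

/-- The delicate case is γ ⪰ β: then γ ⪰ σ ⪰ ν ⪰ γ, so γ and σ are equivalent, and hence so is β. -/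
theorem ge_of_add_ge {β γ σ ν : PosRoot e} (hσ : σ.1 = β.1 + γ.1) (h : P.ge σ ν) (h' : P.ge ν γ) :
    P.ge β ν := by
  rcases P.total β γ with h1 | h1
  · exact P.trans _ _ _ (P.convex _ _ _ hσ h1).1 h
  · have h2 := P.convex _ _ _ (hσ.trans (add_comm _ _)) h1
    have h3 := P.isImaginary_of_add_equiv hσ h2.1 (P.trans _ _ _ h h')
    exact P.trans _ _ _ h3.2 (P.trans _ _ _ h2.1 h)

theorem ge_of_ge_add {β γ σ ν : PosRoot e} (hσ : σ.1 = β.1 + γ.1) (h : P.ge ν σ) (h' : P.ge γ ν) :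
    P.ge ν β := by
  rcases P.total γ β with h1 | h1
  · exact P.trans _ _ _ h (P.convex _ _ _ (hσ.trans (add_comm _ _)) h1).2
  · have h2 := P.convex _ _ _ hσ h1
    have h3 := P.isImaginary_of_add_equiv hσ (P.trans _ _ _ h' h) h2.2
    exact P.trans _ _ _ (P.trans _ _ _ h h2.2) h3.1

theorem eq_zero_of_gt_of_ge {β : PosRoot e} {θ : RootCone e}
    (h : IsSumOfRoots (fun γ => P.gt γ β) θ) (h' : IsSumOfRoots (fun γ => P.ge β γ) θ) : θ = 0 := by
  refine eq_zero_of_isSumOfRoots (fun γ => P.gt γ β) (fun _ _ _ hσ => P.add_gt hσ) ?_ ?_ h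
    (h'.mono fun γ h => P.not_gt.2 h)
  · intro a b c hσ h1 h2
    rw [P.not_gt] at *
    exact P.ge_add hσ h1 h2
  · exact fun a b ha hb h => P.gt_of_ge_of_gt (P.ge_of_isImaginary hb ha) h

theorem eq_zero_of_ge_of_gt {β : PosRoot e} {θ : RootCone e}
    (h : IsSumOfRoots (fun γ => P.ge γ β) θ) (h' : IsSumOfRoots (fun γ => P.gt β γ) θ) : θ = 0 := by
  refine eq_zero_of_isSumOfRoots (fun γ => P.ge γ β) (fun _ _ _ hσ => P.add_ge hσ) ?_ ?_ h
    (h'.mono fun γ h => P.not_ge.2 h)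
  · intro a b c hσ h1 h2
    rw [P.not_ge] at *
    exact P.gt_add hσ h1 h2
  · exact fun a b ha hb h => P.trans _ _ _ (P.ge_of_isImaginary hb ha) h

end ConvexPreorder

theorem isSumOfRoots_smul {p : PosRoot e → Prop} {β : PosRoot e} (hβ : p β) (m : ℕ) :
    IsSumOfRoots p (m • β.1) :=
  ⟨List.replicate m β, fun γ hγ => by rwa [List.eq_of_mem_replicate hγ], by simp⟩

theorem smul_posRoot_ne_zero {β : PosRoot e} {m : ℕ} (hm : 0 < m) : m • β.1 ≠ 0 := by
  intro h
  have h1 := congrArg height h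
  have h2 : height (0 : RootCone e) = 0 := by simp [height]
  rw [height_smul, h2] at h1
  have := height_pos β.2
  exact (Nat.mul_pos hm this).ne' h1

namespace ConvexPreorder

/-- Otherwise the common multiple would be a sum of copies of β and also of copies of a root ≻ β. -/
theorem ge_of_smul_eq_smul (P : ConvexPreorder e) {β γ : PosRoot e} {m n : ℕ} (hm : 0 < m)
    (h : m • β.1 = n • γ.1) : P.ge β γ := by
  rw [← P.not_gt]
  intro hc
  refine smul_posRoot_ne_zero hm (P.eq_zero_of_gt_of_ge (β := β) ?_ (isSumOfRoots_smul (P.refl β) m))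
  rw [h]
  exact isSumOfRoots_smul (p := fun ν => P.gt ν β) hc n

end ConvexPreorder

/-! ### Potentials -/

/-- The root `α_n + ⋯ + α_{m-1}`, for integers `n < m`. -/
def arc (e : ℕ) (n m : ℤ) : PosRoot e :=
  ⟨alpha (n : ZMod e) ((m - n - 1).toNat + 1), _, _, Nat.succ_pos _, rfl⟩

theorem arc_val {n m : ℤ} (h : n < m) : (arc e n m).1 = alpha (n : ZMod e) (m - n).toNat := by
  have h1 : (m - n).toNat = (m - n - 1).toNat + 1 := by omega
  rw [arc, h1]

theorem arc_add {n m k : ℤ} (h : n < m) (h' : m < k) :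
    (arc e n k).1 = (arc e n m).1 + (arc e m k).1 := by
  rw [arc_val h, arc_val h', arc_val (h.trans h')]
  have h1 : (k - n).toNat = (m - n).toNat + (k - m).toNat := by omega
  have h2 : (m : ZMod e) = (n : ZMod e) + ((m - n).toNat : ZMod e) := by
    rw [← Int.cast_natCast, Int.toNat_of_nonneg (by omega)]
    push_cast
    ring
  rw [h1, alpha_add, ← h2]

theorem exists_rat_embedding {α : Type*} [Countable α] (r : α → α → Prop) (hr : ∀ a, r a a)
    (ht : ∀ a b c, r a b → r b c → r a c) (htot : ∀ a b, r a b ∨ r b a) :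
    ∃ p : α → ℚ, ∀ a b, r a b ↔ p a ≤ p b := by
  classical
  let _ : Preorder α := { le := r, le_refl := hr, le_trans := ht }
  have : Std.Total (α := α) (· ≤ ·) := ⟨htot⟩
  have : Countable (Antisymmetrization α (· ≤ ·)) := Quotient.countable
  obtain ⟨f⟩ := Order.embedding_from_countable_to_dense (Antisymmetrization α (· ≤ ·)) ℚ
  exact ⟨fun a => f (toAntisymmetrization (· ≤ ·) a), fun a b => by
    rw [f.le_iff_le, toAntisymmetrization_le_toAntisymmetrization_iff]; rfl⟩

namespace ConvexPreorder

variable (P : ConvexPreorder e)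

/-- The preorder on `ℤ` in which `n < m` are compared according to the comparison of the root
`α_n + ⋯ + α_{m-1}` with `β`. -/
def intLE (β : PosRoot e) (n m : ℤ) : Prop :=
  n = m ∨ (n < m ∧ P.ge (arc e n m) β) ∨ (m < n ∧ P.ge β (arc e m n))

/-- For three distinct integers, the longest arc is the concatenation of the other two. Each order
of `a`, `b`, `c` is an instance of closure under sums or of the two-out-of-three property
`ge_of_add_ge`, `ge_of_ge_add`. -/
theorem intLE_trans (β : PosRoot e) {a b c : ℤ} (h : P.intLE β a b) (h' : P.intLE β b c) :
    P.intLE β a c := by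
  rcases h with rfl | ⟨h1, h2⟩ | ⟨h1, h2⟩
  · exact h'
  · rcases h' with rfl | ⟨h3, h4⟩ | ⟨h3, h4⟩
    · exact Or.inr (Or.inl ⟨h1, h2⟩)
    · exact Or.inr (Or.inl ⟨h1.trans h3, P.add_ge (arc_add h1 h3) h2 h4⟩)
    · rcases lt_trichotomy a c with h5 | rfl | h5
      · exact Or.inr (Or.inl ⟨h5, P.ge_of_add_ge (arc_add h5 h3) h2 h4⟩)
      · exact Or.inl rfl
      · exact Or.inr (Or.inr ⟨h5, P.ge_of_ge_add (arc_add h5 h1) h4 h2⟩)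
  · rcases h' with rfl | ⟨h3, h4⟩ | ⟨h3, h4⟩
    · exact Or.inr (Or.inr ⟨h1, h2⟩)
    · rcases lt_trichotomy a c with h5 | rfl | h5
      · exact Or.inr (Or.inl ⟨h5, P.ge_of_add_ge ((arc_add h1 h5).trans (add_comm _ _)) h4 h2⟩)
      · exact Or.inl rfl
      · exact Or.inr (Or.inr ⟨h5, P.ge_of_ge_add ((arc_add h3 h5).trans (add_comm _ _)) h2 h4⟩)
    · exact Or.inr (Or.inr ⟨h3.trans h1, P.ge_add (arc_add h3 h1) h4 h2⟩)

theorem intLE_total (β : PosRoot e) (a b : ℤ) : P.intLE β a b ∨ P.intLE β b a := by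
  rcases lt_trichotomy a b with h | rfl | h
  · rcases P.total (arc e a b) β with h1 | h1
    · exact Or.inl (Or.inr (Or.inl ⟨h, h1⟩))
    · exact Or.inr (Or.inr (Or.inr ⟨h, h1⟩))
  · exact Or.inl (Or.inl rfl)
  · rcases P.total (arc e b a) β with h1 | h1
    · exact Or.inr (Or.inr (Or.inl ⟨h, h1⟩))
    · exact Or.inl (Or.inr (Or.inr ⟨h, h1⟩))

open scoped Classical in
/-- A rational-valued function inducing the relation `r`, if there is one. -/
def rankFun (r : ℤ → ℤ → Prop) : ℤ → ℚ :=
  if h : ∃ p : ℤ → ℚ, ∀ a b, r a b ↔ p a ≤ p b then h.choose else 0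

/-- A function `p` on `ℤ` such that, for `n < m`, the sign of `p m - p n` tells how the root
`α_n + ⋯ + α_{m-1}` compares with `β`. -/
def potential (β : PosRoot e) : ℤ → ℚ := rankFun (P.intLE β)

theorem potential_le_iff (β : PosRoot e) (n m : ℤ) :
    P.potential β n ≤ P.potential β m ↔ P.intLE β n m := by
  have h := exists_rat_embedding (P.intLE β) (fun _ => Or.inl rfl)
    (fun _ _ _ => P.intLE_trans β) (P.intLE_total β)
  rw [potential, rankFun, dif_pos h]
  exact (h.choose_spec n m).symm

theorem potential_le {β : PosRoot e} {n m : ℤ} (h : n < m) :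
    P.potential β n ≤ P.potential β m ↔ P.ge (arc e n m) β := by
  rw [potential_le_iff, intLE]
  constructor
  · rintro (h1 | h1 | h1)
    · omega
    · exact h1.2
    · omega
  · exact fun h1 => Or.inr (Or.inl ⟨h, h1⟩)

theorem le_potential {β : PosRoot e} {n m : ℤ} (h : n < m) :
    P.potential β m ≤ P.potential β n ↔ P.ge β (arc e n m) := by
  rw [potential_le_iff, intLE]
  constructor
  · rintro (h1 | h1 | h1)
    · omega
    · omega
    · exact h1.2
  · exact fun h1 => Or.inr (Or.inr ⟨h, h1⟩)

/-- The potentials are equal, not merely of the same sign, because `rankFun` makes its choice from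
the relation alone. -/
theorem potential_congr {β γ : PosRoot e} (h : P.ge β γ) (h' : P.ge γ β) :
    P.potential β = P.potential γ := by
  have : P.intLE β = P.intLE γ := by
    funext n m
    apply propext
    unfold intLE
    have h1 : ∀ ν, P.ge ν β ↔ P.ge ν γ := fun ν =>
      ⟨fun h1 => P.trans _ _ _ h1 h, fun h1 => P.trans _ _ _ h1 h'⟩
    have h2 : ∀ ν, P.ge β ν ↔ P.ge γ ν := fun ν =>
      ⟨fun h1 => P.trans _ _ _ h' h1, fun h1 => P.trans _ _ _ h h1⟩
    rw [h1, h2]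
  rw [potential, potential, this]

end ConvexPreorder

/-! ### Order ideals and filters of skew shapes -/

/-- The diagonal of a node. -/
def diag (u : Node) : ℤ := u.2 - u.1

/-- `I` is a subset of `τ` closed, within `τ`, under passing from `u` to the `v` with `r v u`.
For `r = (· ≤ ·)` these are the order ideals of `τ`, for `r = (· ≥ ·)` the order filters. -/
def Low (r : Node → Node → Prop) (I τ : Finset Node) : Prop :=
  I ⊆ τ ∧ ∀ u ∈ I, ∀ v ∈ τ, r v u → v ∈ I

section Low

variable {r : Node → Node → Prop} {I J K τ σ : Finset Node}

theorem Low.refl (r : Node → Node → Prop) (τ : Finset Node) : Low r τ τ :=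
  ⟨subset_rfl, fun _ _ _ hv _ => hv⟩

theorem Low.trans (h : Low r I J) (h' : Low r J K) : Low r I K :=
  ⟨h.1.trans h'.1, fun u hu v hv huv => h.2 u hu v (h'.2 u (h.1 hu) v hv huv) huv⟩

theorem Low.sdiff (h : Low r I τ) : Low (Function.swap r) (τ \ I) τ := by
  refine ⟨Finset.sdiff_subset, fun u hu v hv huv => ?_⟩
  rw [Finset.mem_sdiff] at *
  exact ⟨hv, fun hc => hu.2 (h.2 v hc u hu.1 huv)⟩

theorem Low.inter (h : Low r I τ) (hσ : σ ⊆ τ) : Low r (I ∩ σ) σ := by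
  refine ⟨Finset.inter_subset_right, fun u hu v hv huv => ?_⟩
  rw [Finset.mem_inter] at *
  exact ⟨h.2 u hu.1 v (hσ hv) huv, hv⟩

theorem Low.union_of_sdiff (h : Low r I τ) (h' : Low r J (τ \ I)) : Low r (I ∪ J) τ := by
  refine ⟨Finset.union_subset h.1 (h'.1.trans Finset.sdiff_subset), fun u hu v hv huv => ?_⟩
  rw [Finset.mem_union] at *
  rcases hu with hu | hu
  · exact Or.inl (h.2 u hu v hv huv)
  · by_cases hc : v ∈ I
    · exact Or.inl hc
    · exact Or.inr (h'.2 u hu v (Finset.mem_sdiff.2 ⟨hv, hc⟩) huv)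

theorem Low.isSkewShape (hr : r = (· ≤ ·) ∨ r = (· ≥ ·)) (h : Low r I τ) (hτ : IsSkewShape τ) :
    IsSkewShape I := by
  intro u hu w hw v huv hvw
  have hv := hτ u (h.1 hu) w (h.1 hw) v huv hvw
  rcases hr with rfl | rfl
  · exact h.2 w hw v hv hvw
  · exact h.2 u hu v hv huv

end Low

/-- The sum over the nodes of `σ` of the increments of `p` along the diagonals. -/
def weight (p : ℤ → ℚ) (σ : Finset Node) : ℚ := ∑ u ∈ σ, (p (diag u + 1) - p (diag u))

@[simp]
theorem weight_empty (p : ℤ → ℚ) : weight p ∅ = 0 := by simp [weight]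

theorem weight_union (p : ℤ → ℚ) {I J : Finset Node} (h : Disjoint I J) :
    weight p (I ∪ J) = weight p I + weight p J := Finset.sum_union h

theorem weight_sdiff (p : ℤ → ℚ) {I τ : Finset Node} (h : I ⊆ τ) :
    weight p (τ \ I) = weight p τ - weight p I := by
  rw [eq_sub_iff_add_eq]
  exact Finset.sum_sdiff h

theorem content_sdiff_add {I τ : Finset Node} (h : I ⊆ τ) :
    content e (τ \ I) + content e I = content e τ := Finset.sum_sdiff h

theorem height_content (σ : Finset Node) : height (content e σ) = σ.card := by
  induction σ using Finset.induction with
  | empty => simp [content, height]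
  | insert u σ hu ih =>
    rw [content, Finset.sum_insert hu, height_add, Finset.card_insert_of_notMem hu, ← ih, content]
    simp [simpleRoot, height, add_comm]

theorem content_ne_zero {σ : Finset Node} (h : σ.Nonempty) : content e σ ≠ 0 := by
  intro hc
  have h1 := height_content (e := e) σ
  have h2 : height (0 : RootCone e) = 0 := by simp [height]
  have h3 := h.card_pos
  rw [hc, h2] at h1
  omega

/-! ### Ribbons -/

/-- The nodes of `σ` lie on different diagonals, which are those numbered `n, …, m - 1`. -/
structure IsRibbon (σ : Finset Node) (n m : ℤ) : Prop where
  lt : n < m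
  inj : Set.InjOn diag (σ : Set Node)
  image : σ.image diag = Finset.Ico n m

theorem sum_Ico_int {M : Type*} [AddCommMonoid M] (f : ℤ → M) (n m : ℤ) :
    ∑ k ∈ Finset.Ico n m, f k = ∑ i ∈ Finset.range (m - n).toNat, f (n + i) := by
  refine Finset.sum_nbij' (fun k => (k - n).toNat) (fun i => n + i) ?_ ?_ ?_ ?_ ?_ <;>
    simp only [Finset.mem_Ico, Finset.mem_range]
  · intro a; omega
  · intro a; omega
  · intro a; omega
  · intro a; omega
  · intro a ha
    congr 1
    omega

namespace IsRibbon

variable {σ : Finset Node} {n m : ℤ}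

theorem sum_eq (h : IsRibbon σ n m) {M : Type*} [AddCommMonoid M] (f : ℤ → M) :
    ∑ u ∈ σ, f (diag u) = ∑ i ∈ Finset.range (m - n).toNat, f (n + i) := by
  rw [← sum_Ico_int, ← h.image, Finset.sum_image h.inj]

theorem weight_eq (h : IsRibbon σ n m) (p : ℤ → ℚ) : weight p σ = p m - p n := by
  rw [weight, h.sum_eq fun k => p (k + 1) - p k]
  have := Finset.sum_range_sub (fun i : ℕ => p (n + i)) (m - n).toNat
  simp only [Nat.cast_add, Nat.cast_one, ← add_assoc, Nat.cast_zero, add_zero] at this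
  rw [this, Int.toNat_of_nonneg (by have := h.lt; omega), add_sub_cancel]

theorem content_eq (h : IsRibbon σ n m) : content e σ = (arc e n m).1 := by
  have h1 := h.sum_eq fun k => (simpleRoot (k : ZMod e) : RootCone e)
  rw [arc_val h.lt, alpha]
  refine (Eq.trans rfl h1).trans ?_
  push_cast
  rfl

end IsRibbon

/-- Moving along the row of `u` raises the diagonal, along its column lowers it; the required node
is found in one of the two. -/
theorem IsSkewShape.exists_diag_eq {σ : Finset Node} (hσ : IsSkewShape σ) {u v : Node} (hu : u ∈ σ)
    (hv : v ∈ σ) (huv : u ≤ v) {k : ℤ} (hk : (diag u ≤ k ∧ k ≤ diag v) ∨ (diag v ≤ k ∧ k ≤ diag u)) :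
    ∃ w ∈ σ, diag w = k ∧ u ≤ w ∧ w ≤ v := by
  obtain ⟨a, b⟩ := u
  obtain ⟨c, d⟩ := v
  simp only [diag, Prod.mk_le_mk] at *
  have key : ∀ w : Node, diag w = k → (a, b) ≤ w → w ≤ (c, d) →
      ∃ w ∈ σ, w.2 - w.1 = k ∧ (a, b) ≤ w ∧ w ≤ (c, d) :=
    fun w h1 h2 h3 => ⟨w, hσ _ hu _ hv w h2 h3, h1, h2, h3⟩
  rcases hk with hk | hk
  · refine key (a, a + k) ?_ ?_ ?_ <;> simp only [diag, Prod.mk_le_mk] <;> omega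
  · refine key (b - k, b) ?_ ?_ ?_ <;> simp only [diag, Prod.mk_le_mk] <;> omega

/-- Translation by (1, 1) preserves diagonals, hence weights. It carries the ideal of nodes with a
southeast diagonal neighbour onto the filter of nodes with a northwest one, so no diagonal can hold
two nodes. A skipped diagonal would make the nodes before it both an ideal and a filter. -/
theorem exists_isRibbon {σ : Finset Node} (hσ : IsSkewShape σ) (hne : σ.Nonempty) (p : ℤ → ℚ)
    (h : ∀ I F, Low (· ≤ ·) I σ → Low (· ≥ ·) F σ → I.Nonempty → F.Nonempty → I ≠ σ → F ≠ σ →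
      weight p I ≠ weight p F) : ∃ n m, IsRibbon σ n m := by
  classical
  have step1 : ∀ u ∈ σ, u + (1, 1) ∉ σ := by
    intro u hu hu'
    have hle : ∀ v : Node, v ≤ v + (1, 1) := fun v => by
      obtain ⟨a, b⟩ := v
      simp
    refine h (σ.filter fun u => u + (1, 1) ∈ σ) (σ.filter fun u => u - (1, 1) ∈ σ)
      ⟨Finset.filter_subset _ _, ?_⟩ ⟨Finset.filter_subset _ _, ?_⟩
      ⟨u, by simp [hu, hu']⟩ ⟨u + (1, 1), by simp [hu, hu']⟩ ?_ ?_ ?_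
    · intro a ha b hb hab
      rw [Finset.mem_filter] at *
      exact ⟨hb, hσ b hb _ ha.2 _ (hle b) (by gcongr)⟩
    · intro a ha b hb hab
      rw [Finset.mem_filter] at *
      refine ⟨hb, hσ _ ha.2 _ hb _ (by gcongr) ?_⟩
      simpa using hle (b - (1, 1))
    · intro hc
      obtain ⟨v, hv, hmax⟩ := σ.exists_max_image (fun u => u.1) hne
      have h1 : v + (1, 1) ∈ σ := by
        rw [← hc] at hv
        exact (Finset.mem_filter.1 hv).2
      have := hmax _ h1
      simp at this
    · intro hc
      obtain ⟨v, hv, hmin⟩ := σ.exists_min_image (fun u => u.1) hne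
      have h1 : v - (1, 1) ∈ σ := by
        rw [← hc] at hv
        exact (Finset.mem_filter.1 hv).2
      have := hmin _ h1
      simp at this
    · refine Finset.sum_nbij' (fun u => u + (1, 1)) (fun u => u - (1, 1)) ?_ ?_ ?_ ?_ ?_
      · intro a ha
        simp only [Finset.mem_filter] at *
        simpa using ha.symm
      · intro a ha
        simp only [Finset.mem_filter] at *
        simpa using ha.symm
      · simp
      · simp
      · intro a _
        simp [diag]
  have step2 : ∀ u ∈ σ, ∀ v ∈ σ, diag u = diag v → ¬ u.1 < v.1 := by
    intro u hu v hv huv hlt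
    refine step1 u hu (hσ u hu v hv _ ?_ ?_) <;>
    · obtain ⟨a, b⟩ := u
      obtain ⟨c, d⟩ := v
      simp only [diag, Prod.mk_add_mk, Prod.mk_le_mk] at *
      omega
  obtain ⟨a, ha, hmin⟩ := σ.exists_min_image diag hne
  obtain ⟨b, hb, hmax⟩ := σ.exists_max_image diag hne
  refine ⟨diag a, diag b + 1, by have := hmax a ha; omega, ?_, ?_⟩
  · intro u hu v hv huv
    have h1 := step2 u hu v hv huv
    have h2 := step2 v hv u hu huv.symm
    obtain ⟨a, b⟩ := u
    obtain ⟨c, d⟩ := v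
    simp only [diag, Prod.mk.injEq] at *
    omega
  · ext k
    rw [Finset.mem_image, Finset.mem_Ico]
    constructor
    · rintro ⟨u, hu, rfl⟩
      have := hmin u hu
      have := hmax u hu
      omega
    · rintro ⟨h1, h2⟩
      by_contra hk
      push Not at hk
      have hka := hk a ha
      have hkb := hk b hb
      have hA : (σ.filter fun u => diag u < k).Nonempty :=
        ⟨a, Finset.mem_filter.2 ⟨ha, by omega⟩⟩
      have hA' : (σ.filter fun u => diag u < k) ≠ σ := by
        intro hc
        rw [← hc, Finset.mem_filter] at hb
        omega
      refine h _ _ ⟨Finset.filter_subset _ _, ?_⟩ ⟨Finset.filter_subset _ _, ?_⟩ hA hA hA' hA' rfl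
      · intro u hu v hv hvu
        rw [Finset.mem_filter] at *
        refine ⟨hv, ?_⟩
        by_contra hc
        obtain ⟨w, hw, hwk, -⟩ := hσ.exists_diag_eq hv hu.1 hvu (k := k) (by omega)
        exact hk w hw hwk
      · intro u hu v hv hvu
        rw [Finset.mem_filter] at *
        refine ⟨hv, ?_⟩
        by_contra hc
        obtain ⟨w, hw, hwk, -⟩ := hσ.exists_diag_eq hu.1 hv hvu (k := k) (by omega)
        exact hk w hw hwk

/-- A ribbon can be cut at any place into an ideal and a filter. -/
theorem IsRibbon.low_or_low {σ : Finset Node} {n m k : ℤ} (hσ : IsSkewShape σ) (h : IsRibbon σ n m) :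
    Low (· ≤ ·) (σ.filter fun u => diag u < k) σ ∨ Low (· ≤ ·) (σ.filter fun u => k ≤ diag u) σ := by
  by_contra hc
  rw [not_or] at hc
  obtain ⟨h1, h2⟩ := hc
  have h1' : ∃ u ∈ σ, ∃ v ∈ σ, v ≤ u ∧ diag u < k ∧ k ≤ diag v := by
    by_contra hc
    push Not at hc
    refine h1 ⟨Finset.filter_subset _ _, fun u hu v hv hvu => ?_⟩
    rw [Finset.mem_filter] at *
    exact ⟨hv, hc u hu.1 v hv hvu hu.2⟩
  have h2' : ∃ u ∈ σ, ∃ v ∈ σ, v ≤ u ∧ k ≤ diag u ∧ diag v < k := by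
    by_contra hc
    push Not at hc
    refine h2 ⟨Finset.filter_subset _ _, fun u hu v hv hvu => ?_⟩
    rw [Finset.mem_filter] at *
    exact ⟨hv, hc u hu.1 v hv hvu hu.2⟩
  -- If both fail, there are southeast moves from diagonal `k` to `k - 1` and from `k - 1` to `k`. A
  -- ribbon has one node on each diagonal, so these two nodes bound each other.
  obtain ⟨u, hu, v, hv, hvu, hu1, hv1⟩ := h1'
  obtain ⟨w1, hw1, hk1, -, hwu⟩ := hσ.exists_diag_eq hv hu hvu (k := k) (by omega)
  obtain ⟨w2, hw2, hk2, hw12, -⟩ := hσ.exists_diag_eq hw1 hu hwu (k := k - 1) (by omega)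
  obtain ⟨u', hu', v', hv', hvu', hu1', hv1'⟩ := h2'
  obtain ⟨x1, hx1, hl1, -, hxu⟩ := hσ.exists_diag_eq hv' hu' hvu' (k := k - 1) (by omega)
  obtain ⟨x2, hx2, hl2, hx12, -⟩ := hσ.exists_diag_eq hx1 hu' hxu (k := k) (by omega)
  have e1 : w1 = x2 := h.inj hw1 hx2 (by omega)
  have e2 : w2 = x1 := h.inj hw2 hx1 (by omega)
  subst e1 e2
  have := le_antisymm hw12 hx12
  rw [this] at hk1
  omega

theorem IsRibbon.filter_lt {σ : Finset Node} {n m k : ℤ} (h : IsRibbon σ n m) (hn : n < k)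
    (hm : k ≤ m) : IsRibbon (σ.filter fun u => diag u < k) n k := by
  refine ⟨hn, h.inj.mono fun u hu => (Finset.mem_filter.1 hu).1, ?_⟩
  ext i
  have := Finset.ext_iff.1 h.image i
  simp only [Finset.mem_image, Finset.mem_Ico, Finset.mem_filter] at *
  constructor
  · rintro ⟨u, ⟨hu, hu'⟩, rfl⟩
    have := this.1 ⟨u, hu, rfl⟩
    omega
  · intro hi
    obtain ⟨u, hu, rfl⟩ := this.2 (by omega)
    exact ⟨u, ⟨hu, hi.2⟩, rfl⟩

theorem IsRibbon.filter_ge {σ : Finset Node} {n m k : ℤ} (h : IsRibbon σ n m) (hn : n ≤ k)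
    (hm : k < m) : IsRibbon (σ.filter fun u => k ≤ diag u) k m := by
  refine ⟨hm, h.inj.mono fun u hu => (Finset.mem_filter.1 hu).1, ?_⟩
  ext i
  have := Finset.ext_iff.1 h.image i
  simp only [Finset.mem_image, Finset.mem_Ico, Finset.mem_filter] at *
  constructor
  · rintro ⟨u, ⟨hu, hu'⟩, rfl⟩
    have := this.1 ⟨u, hu, rfl⟩
    omega
  · intro hi
    obtain ⟨u, hu, rfl⟩ := this.2 (by omega)
    exact ⟨u, ⟨hu, hi.1⟩, rfl⟩

theorem IsRibbon.nonempty {σ : Finset Node} {n m : ℤ} (h : IsRibbon σ n m) : σ.Nonempty := by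
  rw [← Finset.image_nonempty (f := diag), h.image, Finset.nonempty_Ico]
  exact h.lt

/-- If `Q` holds for the weight of `σ`, then there is a ribbon among the ideals (or filters) of `σ`
for which `Q` holds and which is minimal as such. -/
theorem exists_low_isRibbon {r : Node → Node → Prop} (hr : r = (· ≤ ·) ∨ r = (· ≥ ·))
    {Q : ℚ → Prop} (hQ : ∀ a b, Q a → ¬ Q b → Q (a - b)) (p : ℤ → ℚ) {σ : Finset Node}
    (hσ : IsSkewShape σ) (hne : σ.Nonempty) (h : Q (weight p σ)) :
    ∃ R n m, Low r R σ ∧ IsRibbon R n m ∧ Q (weight p R) ∧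
      ∀ I, Low r I R → I.Nonempty → I ≠ R → ¬ Q (weight p I) := by
  induction σ using Finset.strongInduction with
  | H σ ih =>
  by_cases hc : ∃ I, Low r I σ ∧ I.Nonempty ∧ I ≠ σ ∧ Q (weight p I)
  · obtain ⟨I, hI, hIne, hIσ, hQI⟩ := hc
    obtain ⟨R, n, m, h1, h2, h3, h4⟩ := ih I (hI.1.ssubset_of_ne hIσ) (hI.isSkewShape hr hσ) hIne hQI
    exact ⟨R, n, m, h1.trans hI, h2, h3, h4⟩
  · push Not at hc
    -- No proper nonempty ideal satisfies `Q`, so by `hQ` all complementary filters do. An ideal and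
    -- a filter thus never share a weight, and `exists_isRibbon` applies.
    have hsd : ∀ I, Low (Function.swap r) I σ → I.Nonempty → I ≠ σ → Q (weight p I) := by
      intro I hI hIne hIσ
      have hlow : Low r (σ \ I) σ := hI.sdiff
      have h1 : (σ \ I).Nonempty := by
        rw [Finset.sdiff_nonempty]
        exact fun hc => hIσ (hI.1.antisymm hc)
      have h2 : σ \ I ≠ σ := by
        intro h2
        obtain ⟨x, hx⟩ := hIne
        have := hI.1 hx
        rw [← h2, Finset.mem_sdiff] at this
        exact this.2 hx
      have h3 := hQ _ _ h (hc _ hlow h1 h2)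
      rwa [weight_sdiff p hI.1, sub_sub_cancel] at h3
    obtain ⟨n, m, hR⟩ : ∃ n m, IsRibbon σ n m := by
      refine exists_isRibbon hσ hne p fun I F hI hF hI0 hF0 hI1 hF1 heq => ?_
      rcases hr with rfl | rfl
      · exact hc I hI hI0 hI1 (heq ▸ hsd F hF hF0 hF1)
      · exact hc F hF hF0 hF1 (heq ▸ hsd I hI hI0 hI1)
    exact ⟨σ, n, m, Low.refl r σ, hR, h, hc⟩

/-- If `Q` holds for the weights of all ideals (or of all filters) of `σ`, then `σ` is filtered by
ribbons for which `Q` holds. -/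
theorem exists_arcs_of_low {r : Node → Node → Prop} (hr : r = (· ≤ ·) ∨ r = (· ≥ ·))
    {Q : ℚ → Prop} (hQ : ∀ a b, Q a → ¬ Q b → Q (a - b)) (p : ℤ → ℚ) {σ : Finset Node}
    (hσ : IsSkewShape σ) (h : ∀ I, Low r I σ → I.Nonempty → Q (weight p I)) :
    ∃ l : List (ℤ × ℤ), (∀ x ∈ l, x.1 < x.2 ∧ Q (p x.2 - p x.1)) ∧ (σ.Nonempty → l ≠ []) ∧
      content e σ = (l.map fun x => (arc e x.1 x.2).1).sum ∧
      ∀ q, weight q σ = (l.map fun x => q x.2 - q x.1).sum := by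
  induction σ using Finset.strongInduction with
  | H σ ih =>
  rcases σ.eq_empty_or_nonempty with rfl | hne
  · exact ⟨[], by simp, by simp, by simp [content], by simp⟩
  have hr' : Function.swap r = (· ≤ ·) ∨ Function.swap r = (· ≥ ·) := by
    rcases hr with rfl | rfl
    · exact Or.inr rfl
    · exact Or.inl rfl
  -- The ribbon is peeled off at the opposite end, so that ideals (filters) of the remainder are
  -- still ideals (filters) of `σ`.
  obtain ⟨R, n, m, h1, h2, h3, -⟩ :=
    exists_low_isRibbon hr' hQ p hσ hne (h σ (Low.refl r σ) hne)
  have hlow : Low r (σ \ R) σ := h1.sdiff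
  obtain ⟨l, hl1, -, hl2, hl3⟩ := ih (σ \ R) (Finset.sdiff_ssubset h1.1 h2.nonempty)
    (hlow.isSkewShape hr hσ) fun I hI => h I (hI.trans hlow)
  refine ⟨(n, m) :: l, ?_, by simp, ?_, ?_⟩
  · intro x hx
    rcases List.mem_cons.1 hx with rfl | hx
    · exact ⟨h2.lt, h2.weight_eq p ▸ h3⟩
    · exact hl1 x hx
  · rw [← content_sdiff_add h1.1, hl2, h2.content_eq]
    simp [add_comm]
  · intro q
    have := weight_sdiff q h1.1
    rw [hl3, h2.weight_eq] at this
    simp only [List.map_cons, List.sum_cons]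
    linarith

/-! ### Indivisible roots -/

/-- Both α(s, e) and α(s+1, e) give α(s, e+1) upon adding α_s. -/
theorem alpha_self_eq (t : ZMod e) (he : 1 < e) : alpha t e = alpha 0 e := by
  have : NeZero e := ⟨by omega⟩
  have step : ∀ s : ZMod e, alpha (s + 1) e = alpha s e := by
    intro s
    have h1 := alpha_add s 1 e
    have h2 := alpha_add s e 1
    rw [add_comm e 1, h1, Nat.cast_one, CharP.cast_eq_zero, add_zero, add_comm] at h2
    exact add_right_cancel h2
  have h : ∀ k : ℕ, alpha (k : ZMod e) e = alpha 0 e := by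
    intro k
    induction k with
    | zero => simp
    | succ k ih => rw [Nat.cast_succ, step, ih]
  have := h t.val
  rwa [ZMod.natCast_val, ZMod.cast_id] at this

theorem alpha_self_apply (he : 1 < e) (t : ZMod e) : alpha t e t = 1 := by
  simp only [alpha, simpleRoot, Finsupp.finsetSum_apply]
  rw [Finset.sum_eq_single 0]
  · simp
  · intro b hb hb0
    rw [Finsupp.single_apply, if_neg]
    intro hc
    have h1 : (b : ZMod e) = 0 := by simpa using hc
    have h2 := Nat.le_of_dvd (by omega) ((ZMod.natCast_eq_zero_iff b e).1 h1)
    have h3 := Finset.mem_range.1 hb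
    omega
  · intro hc
    simp at hc
    omega

/-- A common divisor of the coefficients divides their jump at `t`, which is one unless `e` divides
`h`; for `h = e` a coefficient is itself one. -/
theorem isIndivisible_alpha (he : 1 < e) (t : ZMod e) {h : ℕ} (h0 : (h : ZMod e) ≠ 0 ∨ h = e) :
    IsIndivisible (alpha t h) := by
  have hh : 0 < h := by
    rcases h0 with h0 | h0
    · rcases Nat.eq_zero_or_pos h with rfl | h1
      · simp at h0
      · exact h1
    · omega
  refine ⟨⟨t, h, hh, rfl⟩, ?_⟩
  rintro ⟨m, β, hm, -, hβ⟩
  have hd : ∀ s, m ∣ alpha t h s := fun s => by simp [hβ]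
  have h1 : m ∣ 1 := by
    rcases h0 with h0 | rfl
    · have key := alpha_apply_shift t (t - 1) h
      have hne : ¬ (t = t + (h : ZMod e)) := by simpa using h0
      rw [sub_add_cancel, if_neg hne, if_pos rfl, add_zero] at key
      have h1 := hd t
      rw [key] at h1
      exact (Nat.dvd_add_right (hd (t - 1))).1 h1
    · have := hd t
      rwa [alpha_self_apply he] at this
  have := Nat.le_of_dvd one_pos h1
  omega

theorem eq_alpha_of_isImaginary (he : 1 < e) {ψ : PosRoot e} (h : IsIndivisible ψ.1)
    (hi : IsImaginary ψ) : ψ.1 = alpha 0 e := by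
  obtain ⟨t, k, hk, hψ⟩ := ψ.2
  rw [IsImaginary, hψ, height_alpha] at hi
  obtain ⟨q, rfl⟩ := hi
  have h1 : ¬ 1 < q := fun hq =>
    h.2 ⟨q, alpha t e, hq, ⟨t, e, by omega, rfl⟩, by rw [hψ, alpha_mul]⟩
  have h2 : q ≠ 0 := by
    rintro rfl
    simp at hk
  have h3 : q = 1 := by omega
  rw [hψ, h3, mul_one, alpha_self_eq t he]

/-- Only the imaginary roots form a class with several members, and just one of those, α(0, e), is
indivisible. -/
theorem ConvexPreorder.eq_of_isIndivisible (P : ConvexPreorder e) (he : 1 < e) {ψ φ : PosRoot e}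
    (hψ : IsIndivisible ψ.1) (hφ : IsIndivisible φ.1) (h : P.ge ψ φ) (h' : P.ge φ ψ) : ψ = φ := by
  rcases (P.imaginary_equiv ψ φ).1 ⟨h, h'⟩ with h1 | ⟨h1, h2⟩
  · exact h1
  · exact Subtype.ext
      ((eq_alpha_of_isImaginary he hψ h1).trans (eq_alpha_of_isImaginary he hφ h2).symm)

/-! ### Weights and convex preorders -/

section Sign

variable (P : ConvexPreorder e) {β : PosRoot e} {n m : ℤ}

namespace ConvexPreorder

theorem sub_nonneg_iff (h : n < m) :
    0 ≤ P.potential β m - P.potential β n ↔ P.ge (arc e n m) β := by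
  rw [sub_nonneg, P.potential_le h]

theorem sub_nonpos_iff (h : n < m) :
    P.potential β m - P.potential β n ≤ 0 ↔ P.ge β (arc e n m) := by
  rw [sub_nonpos, P.le_potential h]

theorem sub_pos_iff (h : n < m) :
    0 < P.potential β m - P.potential β n ↔ P.gt (arc e n m) β := by
  rw [← not_le, P.sub_nonpos_iff h, P.not_ge]

theorem sub_neg_iff (h : n < m) :
    P.potential β m - P.potential β n < 0 ↔ P.gt β (arc e n m) := by
  rw [← not_le, P.sub_nonneg_iff h, P.not_ge]

end ConvexPreorder

end Sign

/-! ### Consequences of a sign condition on all ideals or filters -/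

theorem isSumOfRoots_content_of_low {r : Node → Node → Prop} (hr : r = (· ≤ ·) ∨ r = (· ≥ ·))
    {Q : ℚ → Prop} (hQ : ∀ a b, Q a → ¬ Q b → Q (a - b)) {p : ℤ → ℚ} {σ : Finset Node}
    (hσ : IsSkewShape σ) (h : ∀ I, Low r I σ → I.Nonempty → Q (weight p I))
    {S : PosRoot e → Prop} (hS : ∀ n m, n < m → Q (p m - p n) → S (arc e n m)) :
    IsSumOfRoots S (content e σ) := by
  obtain ⟨l, hl, -, hl', -⟩ := exists_arcs_of_low (e := e) hr hQ p hσ h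
  refine ⟨l.map fun x => arc e x.1 x.2, ?_, ?_⟩
  · intro γ hγ
    obtain ⟨x, hx, rfl⟩ := List.mem_map.1 hγ
    exact hS _ _ (hl x hx).1 (hl x hx).2
  · rw [hl', List.map_map]
    rfl

/-- Transfers a sign from one potential to another: both weights are read off the same filtration by
ribbons. -/
theorem weight_of_low {r : Node → Node → Prop} (hr : r = (· ≤ ·) ∨ r = (· ≥ ·))
    {Q : ℚ → Prop} (hQ : ∀ a b, Q a → ¬ Q b → Q (a - b)) {p : ℤ → ℚ} {σ : Finset Node}
    (hσ : IsSkewShape σ) (hne : σ.Nonempty) (h : ∀ I, Low r I σ → I.Nonempty → Q (weight p I))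
    {Q' : ℚ → Prop} (hQ' : ∀ a b, Q' a → Q' b → Q' (a + b)) {q : ℤ → ℚ}
    (hS : ∀ n m, n < m → Q (p m - p n) → Q' (q m - q n)) : Q' (weight q σ) := by
  -- The value of `e` is irrelevant, since the statement about contents is discarded.
  obtain ⟨l, hl, hl0, -, hl'⟩ := exists_arcs_of_low (e := 0) hr hQ p hσ h
  rw [hl']
  have hl1 := hl0 hne
  clear hl' hl0
  induction l with
  | nil => exact absurd rfl hl1
  | cons x l ih =>
    rw [List.map_cons, List.sum_cons]
    have hx := hS _ _ (hl x List.mem_cons_self).1 (hl x List.mem_cons_self).2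
    rcases eq_or_ne l [] with rfl | hl2
    · simpa using hx
    · exact hQ' _ _ hx (ih (fun y hy => hl y (List.mem_cons_of_mem _ hy)) hl2)

theorem nonneg_sub (a b : ℚ) (h : 0 ≤ a) (h' : ¬ 0 ≤ b) : 0 ≤ a - b := by linarith
theorem pos_sub (a b : ℚ) (h : 0 < a) (h' : ¬ 0 < b) : 0 < a - b := by linarith
theorem nonpos_sub (a b : ℚ) (h : a ≤ 0) (h' : ¬ b ≤ 0) : a - b ≤ 0 := by linarith
theorem neg_sub_neg (a b : ℚ) (h : a < 0) (h' : ¬ b < 0) : a - b < 0 := by linarith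

namespace ConvexPreorder

variable (P : ConvexPreorder e)

/-- The weight of a shape with respect to the potential attached to `β`. -/
def wt (β : PosRoot e) (σ : Finset Node) : ℚ := weight (P.potential β) σ

@[simp]
theorem wt_empty (β : PosRoot e) : P.wt β ∅ = 0 := weight_empty _

theorem wt_sdiff (β : PosRoot e) {I τ : Finset Node} (h : I ⊆ τ) :
    P.wt β (τ \ I) = P.wt β τ - P.wt β I := weight_sdiff _ h

theorem wt_union (β : PosRoot e) {I J : Finset Node} (h : Disjoint I J) :
    P.wt β (I ∪ J) = P.wt β I + P.wt β J := weight_union _ h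

theorem wt_congr {β γ : PosRoot e} (h : P.ge β γ) (h' : P.ge γ β) : P.wt β = P.wt γ := by
  funext σ
  rw [wt, wt, P.potential_congr h h']

theorem wt_isRibbon {σ : Finset Node} {n m : ℤ} (β : PosRoot e) (h : IsRibbon σ n m) :
    P.wt β σ = P.potential β m - P.potential β n := h.weight_eq _

variable {P} {β γ : PosRoot e} {σ : Finset Node}

theorem wt_nonpos_of_ideals (hσ : IsSkewShape σ) (h : ∀ I, Low (· ≤ ·) I σ → P.wt β I ≤ 0)
    (hγ : P.ge γ β) : P.wt γ σ ≤ 0 := by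
  rcases σ.eq_empty_or_nonempty with rfl | hne
  · simp
  refine weight_of_low (Or.inl rfl) nonpos_sub hσ hne (fun I hI _ => h I hI)
    (Q' := fun a => a ≤ 0) (fun a b ha hb => add_nonpos ha hb) fun n m hnm hQ => ?_
  rw [P.sub_nonpos_iff hnm] at *
  exact P.trans _ _ _ hγ hQ

theorem wt_neg_of_ideals (hσ : IsSkewShape σ) (hne : σ.Nonempty)
    (h : ∀ I, Low (· ≤ ·) I σ → P.wt β I ≤ 0) (hγ : P.gt γ β) : P.wt γ σ < 0 := by
  refine weight_of_low (Or.inl rfl) nonpos_sub hσ hne (fun I hI _ => h I hI)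
    (Q' := fun a => a < 0) (fun a b ha hb => add_neg ha hb) fun n m hnm hQ => ?_
  rw [P.sub_nonpos_iff hnm] at hQ
  rw [P.sub_neg_iff hnm]
  exact P.gt_of_gt_of_ge hγ hQ

theorem wt_neg_of_ideals' (hσ : IsSkewShape σ) (hne : σ.Nonempty)
    (h : ∀ I, Low (· ≤ ·) I σ → I.Nonempty → P.wt β I < 0) (hγ : P.ge γ β) : P.wt γ σ < 0 := by
  refine weight_of_low (Or.inl rfl) neg_sub_neg hσ hne h
    (Q' := fun a => a < 0) (fun a b ha hb => add_neg ha hb) fun n m hnm hQ => ?_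
  rw [P.sub_neg_iff hnm] at *
  exact P.gt_of_ge_of_gt hγ hQ

theorem wt_pos_of_filters (hσ : IsSkewShape σ) (hne : σ.Nonempty)
    (h : ∀ I, Low (· ≥ ·) I σ → 0 ≤ P.wt β I) (hγ : P.gt β γ) : 0 < P.wt γ σ := by
  refine weight_of_low (Or.inr rfl) nonneg_sub hσ hne (fun I hI _ => h I hI)
    (Q' := fun a => 0 < a) (fun a b ha hb => add_pos ha hb) fun n m hnm hQ => ?_
  rw [P.sub_nonneg_iff hnm] at hQ
  rw [P.sub_pos_iff hnm]
  exact P.gt_of_ge_of_gt hQ hγ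

end ConvexPreorder

/-! ### Semistable and stable shapes -/

/-- A nonempty skew shape of weight zero all of whose ideals have nonpositive weight. -/
structure Semistable (P : ConvexPreorder e) (β : PosRoot e) (σ : Finset Node) : Prop where
  skew : IsSkewShape σ
  nonempty : σ.Nonempty
  wt_eq : P.wt β σ = 0
  wt_le : ∀ I, Low (· ≤ ·) I σ → P.wt β I ≤ 0

/-- A nonempty skew shape of weight zero all of whose proper ideals have negative weight. -/
structure Stable (P : ConvexPreorder e) (β : PosRoot e) (σ : Finset Node) : Prop
    extends Semistable P β σ where
  wt_lt : ∀ I, Low (· ≤ ·) I σ → I.Nonempty → I ≠ σ → P.wt β I < 0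

theorem Low.sdiff_nonempty {r : Node → Node → Prop} {I τ : Finset Node} (h : Low r I τ)
    (hne : I ≠ τ) : (τ \ I).Nonempty := by
  rw [Finset.sdiff_nonempty]
  exact fun hc => hne (h.1.antisymm hc)

theorem sdiff_ne_of_nonempty {I τ : Finset Node} (h : I ⊆ τ) (hne : I.Nonempty) : τ \ I ≠ τ := by
  intro h2
  obtain ⟨x, hx⟩ := hne
  have := h hx
  rw [← h2, Finset.mem_sdiff] at this
  exact this.2 hx

variable {P : ConvexPreorder e} {β : PosRoot e} {σ : Finset Node}

theorem Semistable.wt_ge (h : Semistable P β σ) {F : Finset Node} (hF : Low (· ≥ ·) F σ) :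
    0 ≤ P.wt β F := by
  have h1 := h.wt_le (σ \ F) hF.sdiff
  rw [P.wt_sdiff β hF.1, h.wt_eq] at h1
  linarith

theorem Stable.wt_gt (h : Stable P β σ) {F : Finset Node} (hF : Low (· ≥ ·) F σ)
    (hne : F.Nonempty) (hF' : F ≠ σ) : 0 < P.wt β F := by
  have h1 := h.wt_lt (σ \ F) hF.sdiff (hF.sdiff_nonempty hF') (sdiff_ne_of_nonempty hF.1 hne)
  rw [P.wt_sdiff β hF.1, h.wt_eq] at h1
  linarith

theorem Semistable.congr {γ : PosRoot e} (h : Semistable P β σ) (h1 : P.ge β γ)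
    (h2 : P.ge γ β) : Semistable P γ σ := by
  have := P.wt_congr h1 h2
  exact ⟨h.skew, h.nonempty, this ▸ h.wt_eq, this ▸ h.wt_le⟩

theorem Stable.congr {γ : PosRoot e} (h : Stable P β σ) (h1 : P.ge β γ)
    (h2 : P.ge γ β) : Stable P γ σ :=
  ⟨h.toSemistable.congr h1 h2, P.wt_congr h1 h2 ▸ h.wt_lt⟩

/-- Proper ideals have negative weight and proper filters positive weight, so the shape is a ribbon.
Its root is equivalent to β since the weight vanishes. -/
theorem Stable.exists_content_eq (he : 1 < e) (h : Stable P β σ) :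
    ∃ ψ : PosRoot e, IsIndivisible ψ.1 ∧ content e σ = ψ.1 ∧ P.ge β ψ ∧ P.ge ψ β := by
  obtain ⟨n, m, hR⟩ := exists_isRibbon h.skew h.nonempty (P.potential β)
    fun I F hI hF hI0 hF0 hI1 hF1 heq => by
      have h1 := h.wt_lt I hI hI0 hI1
      have h2 := h.wt_gt hF hF0 hF1
      rw [ConvexPreorder.wt] at h1 h2
      linarith
  have h0 := h.wt_eq
  rw [P.wt_isRibbon β hR] at h0
  have hge := (P.sub_nonpos_iff hR.lt).1 h0.le
  have hle := (P.sub_nonneg_iff hR.lt).1 h0.ge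
  refine ⟨arc e n m, ?_, hR.content_eq, hge, hle⟩
  rw [arc_val hR.lt]
  refine isIndivisible_alpha he _ ?_
  by_contra hc
  rw [not_or, not_not, ZMod.natCast_eq_zero_iff] at hc
  obtain ⟨hd, hne⟩ := hc
  have hlt := hR.lt
  have hle' := Nat.le_of_dvd (by omega) hd
  have him : IsImaginary (arc e n m) := by rwa [IsImaginary, arc_val hR.lt, height_alpha]
  have him' : IsImaginary (arc e n (n + e)) := by
    rw [IsImaginary, arc_val (by omega), height_alpha]
    simp
  -- A longer imaginary ribbon is cut after `e` diagonals. All imaginary roots are equivalent, so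
  -- both pieces have weight zero; one of them is a proper ideal, against stability.
  have hk1 : n < n + e := by omega
  have hk2 : n + e < m := by omega
  have h1 := (P.sub_nonneg_iff hk1).2 (P.trans _ _ _ (P.ge_of_isImaginary him' him) hle)
  have h2 := (P.sub_nonpos_iff hk1).2 (P.trans _ _ _ hge (P.ge_of_isImaginary him him'))
  have hA := hR.filter_lt hk1 hk2.le
  have hB := hR.filter_ge hk1.le hk2
  have hA' := P.wt_isRibbon β hA
  have hB' := P.wt_isRibbon β hB
  obtain ⟨a, ha⟩ := hA.nonempty
  obtain ⟨b, hb⟩ := hB.nonempty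
  rcases hR.low_or_low h.skew (k := n + e) with hl | hl
  · have := h.wt_lt _ hl hA.nonempty fun hc => by
      rw [← hc] at hb
      simp only [Finset.mem_filter] at hb
      omega
    linarith
  · have := h.wt_lt _ hl hB.nonempty fun hc => by
      rw [← hc] at ha
      simp only [Finset.mem_filter] at ha
      omega
    linarith

/-- An ideal minimal among those of nonnegative weight has weight zero, because no ideal has
positive weight. -/
theorem exists_stable_low (hσ : IsSkewShape σ) (h : ∀ I, Low (· ≤ ·) I σ → P.wt β I ≤ 0)
    {I : Finset Node} (hI : Low (· ≤ ·) I σ) (hne : I.Nonempty) (h0 : P.wt β I = 0) :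
    ∃ R, Low (· ≤ ·) R σ ∧ Stable P β R := by
  obtain ⟨R, n, m, h1, h2, h3, h4⟩ := exists_low_isRibbon (Or.inl rfl) nonneg_sub (P.potential β)
    (hI.isSkewShape (Or.inl rfl) hσ) hne h0.ge
  have hR := h1.trans hI
  exact ⟨R, hR, ⟨hR.isSkewShape (Or.inl rfl) hσ, h2.nonempty, (h R hR).antisymm h3,
    fun J hJ => h J (hJ.trans hR)⟩, fun J hJ hJ0 hJ1 => not_le.1 (h4 J hJ hJ0 hJ1)⟩

theorem wt_nonpos_sdiff {τ T : Finset Node} (h : ∀ I, Low (· ≤ ·) I τ → P.wt β I ≤ 0)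
    (hT : Low (· ≤ ·) T τ) (h0 : P.wt β T = 0) :
    ∀ I, Low (· ≤ ·) I (τ \ T) → P.wt β I ≤ 0 := by
  intro I hI
  have h1 := h _ (hT.union_of_sdiff hI)
  rwa [P.wt_union β (Finset.disjoint_of_subset_right hI.1 Finset.disjoint_sdiff), h0,
    zero_add] at h1

/-- Stable ideals are split off one by one. Their contents are equivalent indivisible roots, hence
all equal. -/
theorem Semistable.exists_content_eq (he : 1 < e) (h : Semistable P β σ) :
    ∃ (m : ℕ) (ψ : PosRoot e), 0 < m ∧ IsIndivisible ψ.1 ∧ content e σ = m • ψ.1 ∧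
      P.ge β ψ ∧ P.ge ψ β := by
  induction σ using Finset.strongInduction with
  | H σ ih =>
  obtain ⟨R, hR, hRs⟩ := exists_stable_low h.skew h.wt_le (Low.refl _ σ) h.nonempty h.wt_eq
  obtain ⟨ψ, h1, h2, h3, h4⟩ := hRs.exists_content_eq he
  by_cases hRσ : R = σ
  · subst hRσ
    exact ⟨1, ψ, one_pos, h1, by rw [h2, one_smul], h3, h4⟩
  · have hs : Low (· ≥ ·) (σ \ R) σ := hR.sdiff
    obtain ⟨m, φ, hm, h5, h6, h7, h8⟩ := ih (σ \ R) (Finset.sdiff_ssubset hR.1 hRs.nonempty)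
      ⟨hs.isSkewShape (Or.inr rfl) h.skew, hR.sdiff_nonempty hRσ,
        by rw [P.wt_sdiff β hR.1, h.wt_eq, hRs.wt_eq, sub_zero],
        wt_nonpos_sdiff h.wt_le hR hRs.wt_eq⟩
    have : φ = ψ := P.eq_of_isIndivisible he h5 h1 (P.trans _ _ _ h8 h3) (P.trans _ _ _ h4 h7)
    subst this
    refine ⟨m + 1, φ, by omega, h1, ?_, h3, h4⟩
    rw [← content_sdiff_add hR.1, h6, h2, succ_nsmul]

/-! ### Two-tile tableaux -/

theorem isTwoTableau_sdiff {I : Finset Node} (hσ : IsSkewShape σ) (hI : Low (· ≤ ·) I σ)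
    (hne : I.Nonempty) (hne' : I ≠ σ) : IsTwoTableau σ I (σ \ I) := by
  have hs : Low (· ≥ ·) (σ \ I) σ := hI.sdiff
  have hd : Disjoint I (σ \ I) := Finset.disjoint_sdiff
  have hII : I ≠ σ \ I := fun hc => by
    rw [← hc, disjoint_self] at hd
    exact hne.ne_empty hd
  refine ⟨⟨?_, ?_, ?_, ?_⟩, ?_, ?_, ?_⟩
  · intro μ hμ
    rw [Finset.mem_insert, Finset.mem_singleton] at hμ
    rcases hμ with rfl | rfl
    · exact hne
    · exact hI.sdiff_nonempty hne'
  · intro μ hμ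
    rw [Finset.mem_insert, Finset.mem_singleton] at hμ
    rcases hμ with rfl | rfl
    · exact hI.isSkewShape (Or.inl rfl) hσ
    · exact hs.isSkewShape (Or.inr rfl) hσ
  · intro μ hμ ν hν hμν
    rw [Finset.mem_insert, Finset.mem_singleton] at hμ hν
    rcases hμ with rfl | rfl <;> rcases hν with rfl | rfl
    · exact absurd rfl hμν
    · exact hd
    · exact hd.symm
    · exact absurd rfl hμν
  · rw [Finset.biUnion_insert, Finset.singleton_biUnion]
    exact Finset.union_sdiff_of_subset hI.1
  · intro i j hij
    fin_cases i <;> fin_cases j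
    exacts [rfl, absurd hij hII, absurd hij.symm hII, rfl]
  · simp [Set.pair_comm]
  · intro i j u hu v hv huv
    fin_cases i <;> fin_cases j <;> simp at hu hv ⊢
    exact hu.2 (hI.2 v hv u hu.1 huv)

theorem IsTwoTableau.low {μ₁ μ₂ : Finset Node} (h : IsTwoTableau σ μ₁ μ₂) :
    Low (· ≤ ·) μ₁ σ ∧ Low (· ≥ ·) μ₂ σ ∧ μ₁ ≠ σ ∧ μ₂ ≠ σ := by
  have hne : μ₁ ≠ μ₂ := fun hc => by
    have := h.injective (a₁ := 0) (a₂ := 1) (by simpa using hc)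
    simp at this
  have hd := h.tiling.disjoint μ₁ (by simp) μ₂ (by simp) hne
  have hu : μ₁ ∪ μ₂ = σ := by
    have := h.tiling.union
    rwa [Finset.biUnion_insert, Finset.singleton_biUnion] at this
  have h1 := h.tiling.nonempty μ₁ (by simp)
  have h2 := h.tiling.nonempty μ₂ (by simp)
  have ho : ∀ u ∈ μ₂, ∀ v ∈ μ₁, ¬ u ≤ v := fun u hu v hv huv => by
    have := h.order 1 0 u (by simpa using hu) v (by simpa using hv) huv
    simp at this
  subst hu
  refine ⟨⟨Finset.subset_union_left, ?_⟩, ⟨Finset.subset_union_right, ?_⟩, ?_, ?_⟩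
  · intro u hu v hv hvu
    rcases Finset.mem_union.1 hv with hv | hv
    · exact hv
    · exact absurd hvu (ho v hv u hu)
  · intro u hu v hv hvu
    rcases Finset.mem_union.1 hv with hv | hv
    · exact absurd hvu (ho u hu v hv)
    · exact hv
  · intro hc
    obtain ⟨x, hx⟩ := h2
    exact Finset.disjoint_left.1 hd (hc ▸ Finset.mem_union_right _ hx) hx
  · intro hc
    obtain ⟨x, hx⟩ := h1
    exact Finset.disjoint_left.1 hd hx (hc ▸ Finset.mem_union_left _ hx)

/-! ### Semicuspidal is semistable, cuspidal is stable -/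

/-- Ideals of the first tile are ideals of the shape, so that tile is filtered by ribbons with roots
⪯ ψ; dually for the second tile. -/
theorem Semistable.isSemicuspidal (he : 1 < e) (h : Semistable P β σ) : IsSemicuspidal P σ := by
  obtain ⟨m, ψ, hm, -, h2, h3, h4⟩ := h.exists_content_eq he
  have h' := h.congr h3 h4
  refine ⟨h.skew, m, ψ, hm, h2, fun μ₁ μ₂ ht => ⟨?_, ?_⟩⟩
  · have hl := ht.low.1
    exact isSumOfRoots_content_of_low (Or.inl rfl) nonpos_sub (hl.isSkewShape (Or.inl rfl) h.skew)
      (fun I hI _ => h'.wt_le I (hI.trans hl)) fun n m hnm => (P.sub_nonpos_iff hnm).1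
  · have hl := ht.low.2.1
    exact isSumOfRoots_content_of_low (Or.inr rfl) nonneg_sub (hl.isSkewShape (Or.inr rfl) h.skew)
      (fun I hI _ => h'.wt_ge (hI.trans hl)) fun n m hnm => (P.sub_nonneg_iff hnm).1

theorem Stable.isCuspidal (he : 1 < e) (h : Stable P β σ) : IsCuspidal P σ := by
  obtain ⟨ψ, -, h2, h3, h4⟩ := h.exists_content_eq he
  have h' := h.congr h3 h4
  have hpr : ∀ {r : Node → Node → Prop} {I J : Finset Node}, Low r I J → J ⊆ σ → J ≠ σ → I ≠ σ :=
    fun hl hJ hJσ hc => hJσ (hJ.antisymm (hc ▸ hl.1))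
  refine ⟨h.skew, ψ, h2, fun μ₁ μ₂ ht => ⟨?_, ?_⟩⟩
  · have hl := ht.low.1
    exact isSumOfRoots_content_of_low (Or.inl rfl) neg_sub_neg (hl.isSkewShape (Or.inl rfl) h.skew)
      (fun I hI hne => h'.wt_lt I (hI.trans hl) hne (hpr hI hl.1 ht.low.2.2.1))
      fun n m hnm => (P.sub_neg_iff hnm).1
  · have hl := ht.low.2.1
    exact isSumOfRoots_content_of_low (Or.inr rfl) pos_sub (hl.isSkewShape (Or.inr rfl) h.skew)
      (fun I hI hne => h'.wt_gt (hI.trans hl) hne (hpr hI hl.1 ht.low.2.2.2))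
      fun n m hnm => (P.sub_pos_iff hnm).1

/-- An ideal of positive weight contains a ribbon ideal with root ≻ β, whose content the hypothesis
also writes as a sum of roots ⪯ β. -/
theorem semistable_of_isTwoTableau (hσ : IsSkewShape σ) {m : ℕ} (hm : 0 < m)
    (hc : content e σ = m • β.1)
    (h : ∀ μ₁ μ₂ : Finset Node, IsTwoTableau σ μ₁ μ₂ →
      IsSumOfRoots (fun γ => P.ge β γ) (content e μ₁) ∧
      IsSumOfRoots (fun γ => P.ge γ β) (content e μ₂)) : Semistable P β σ := by
  have hne : σ.Nonempty := by
    rw [Finset.nonempty_iff_ne_empty]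
    rintro rfl
    exact smul_posRoot_ne_zero hm (hc.symm.trans (by simp [content]))
  have hle : ∀ I, Low (· ≤ ·) I σ → P.wt β I ≤ 0 := by
    intro I hI
    by_contra hpos
    have hI0 : I.Nonempty := by
      rw [Finset.nonempty_iff_ne_empty]
      rintro rfl
      simp at hpos
    obtain ⟨R, n, k, h1, h2, h3, -⟩ := exists_low_isRibbon (Or.inl rfl) pos_sub (P.potential β)
      (hI.isSkewShape (Or.inl rfl) hσ) hI0 (not_le.1 hpos)
    rw [h2.weight_eq, P.sub_pos_iff h2.lt] at h3
    refine content_ne_zero (e := e) h2.nonempty (P.eq_zero_of_gt_of_ge (β := β) ?_ ?_)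
    · rw [h2.content_eq, ← one_smul ℕ (arc e n k).1]
      exact isSumOfRoots_smul (p := fun γ => P.gt γ β) h3 1
    · by_cases hR : R = σ
      · rw [hR, hc]
        exact isSumOfRoots_smul (p := fun γ => P.ge β γ) (P.refl β) m
      · exact (h _ _ (isTwoTableau_sdiff hσ (h1.trans hI) h2.nonempty hR)).1
  -- The weight is not defined through the content, so its vanishing needs an argument: negative
  -- weight would give a ribbon filter with root ≺ β.
  refine ⟨hσ, hne, (hle σ (Low.refl _ σ)).antisymm ?_, hle⟩
  by_contra hneg
  obtain ⟨R, n, k, h1, h2, h3, -⟩ := exists_low_isRibbon (Or.inr rfl) neg_sub_neg (P.potential β)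
    hσ hne (not_le.1 hneg)
  rw [h2.weight_eq, P.sub_neg_iff h2.lt] at h3
  refine content_ne_zero (e := e) h2.nonempty (P.eq_zero_of_ge_of_gt (β := β) ?_ ?_)
  · by_cases hR : R = σ
    · rw [hR, hc]
      exact isSumOfRoots_smul (p := fun γ => P.ge γ β) (P.refl β) m
    · have h4 : Low (· ≤ ·) (σ \ R) σ := h1.sdiff
      have h5 := (h _ _ (isTwoTableau_sdiff hσ h4 (h1.sdiff_nonempty hR)
        (sdiff_ne_of_nonempty h1.1 h2.nonempty))).2
      rwa [Finset.sdiff_sdiff_eq_self h1.1] at h5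
  · rw [h2.content_eq, ← one_smul ℕ (arc e n k).1]
    exact isSumOfRoots_smul (p := fun γ => P.gt β γ) h3 1

theorem IsSemicuspidal.exists_semistable (h : IsSemicuspidal P σ) :
    ∃ (m : ℕ) (β : PosRoot e), 0 < m ∧ content e σ = m • β.1 ∧ Semistable P β σ := by
  obtain ⟨hσ, m, β, hm, hc, h⟩ := h
  exact ⟨m, β, hm, hc, semistable_of_isTwoTableau hσ hm hc h⟩

theorem IsCuspidal.exists_stable (h : IsCuspidal P σ) :
    ∃ β : PosRoot e, content e σ = β.1 ∧ Stable P β σ := by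
  obtain ⟨hσ, β, hc, h⟩ := h
  refine ⟨β, hc, semistable_of_isTwoTableau hσ one_pos (by rw [hc, one_smul]) fun μ₁ μ₂ ht =>
    ⟨(h μ₁ μ₂ ht).1.mono fun _ h => h.1, (h μ₁ μ₂ ht).2.mono fun _ h => h.1⟩, ?_⟩
  intro I hI hne hI'
  by_contra hpos
  -- A proper ideal of nonnegative weight contains a ribbon ideal with root ⪰ β, while cuspidality
  -- makes its content a sum of roots ≺ β.
  obtain ⟨R, n, k, h1, h2, h3, -⟩ := exists_low_isRibbon (Or.inl rfl) nonneg_sub (P.potential β)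
    (hI.isSkewShape (Or.inl rfl) hσ) hne (not_lt.1 hpos)
  rw [h2.weight_eq, P.sub_nonneg_iff h2.lt] at h3
  have hR : R ≠ σ := fun hc => hI' (hI.1.antisymm (hc ▸ h1.1))
  refine content_ne_zero (e := e) h2.nonempty (P.eq_zero_of_ge_of_gt (β := β) ?_
    (h _ _ (isTwoTableau_sdiff hσ (h1.trans hI) h2.nonempty hR)).1)
  rw [h2.content_eq, ← one_smul ℕ (arc e n k).1]
  exact isSumOfRoots_smul (p := fun γ => P.ge γ β) h3 1

/-! ### Tableaux -/

namespace IsTableau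

variable {τ : Finset Node} {Λ : Finset (Finset Node)} {n : ℕ} {t : Fin n → Finset Node}

theorem mem (h : IsTableau τ Λ t) (i : Fin n) : t i ∈ Λ := by
  have : t i ∈ (Λ : Set (Finset Node)) := h.range_eq ▸ Set.mem_range_self i
  exact this

theorem exists_eq (h : IsTableau τ Λ t) {μ : Finset Node} (hμ : μ ∈ Λ) : ∃ i, t i = μ := by
  have : μ ∈ Set.range t := h.range_eq ▸ Finset.mem_coe.2 hμ
  exact this

theorem disjoint (h : IsTableau τ Λ t) {i j : Fin n} (hij : i ≠ j) : Disjoint (t i) (t j) :=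
  h.tiling.disjoint _ (h.mem i) _ (h.mem j) (h.injective.ne hij)

theorem index_eq (h : IsTableau τ Λ t) {i j : Fin n} {u : Node} (hi : u ∈ t i) (hj : u ∈ t j) :
    i = j := by
  by_contra hij
  exact Finset.disjoint_left.1 (h.disjoint hij) hi hj

theorem subset (h : IsTableau τ Λ t) (i : Fin n) : t i ⊆ τ := fun u hu => by
  rw [← h.tiling.union, Finset.mem_biUnion]
  exact ⟨t i, h.mem i, hu⟩

theorem exists_mem (h : IsTableau τ Λ t) {u : Node} (hu : u ∈ τ) : ∃ i, u ∈ t i := by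
  rw [← h.tiling.union, Finset.mem_biUnion] at hu
  obtain ⟨μ, hμ, hu⟩ := hu
  obtain ⟨i, rfl⟩ := h.exists_eq hμ
  exact ⟨i, hu⟩

theorem low_biUnion (h : IsTableau τ Λ t) {s : Finset (Fin n)} (hs : ∀ i ∈ s, ∀ j ≤ i, j ∈ s) :
    Low (· ≤ ·) (s.biUnion t) τ := by
  refine ⟨Finset.biUnion_subset.2 fun i _ => h.subset i, fun u hu v hv hvu => ?_⟩
  obtain ⟨i, hi, hu⟩ := Finset.mem_biUnion.1 hu
  obtain ⟨j, hj⟩ := h.exists_mem hv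
  exact Finset.mem_biUnion.2 ⟨j, hs i hi j (h.order j i v hj u hu hvu), hj⟩

theorem biUnion_inter_of_mem {s : Finset (Fin n)} {i : Fin n} (hi : i ∈ s) :
    s.biUnion t ∩ t i = t i :=
  Finset.inter_eq_right.2 (Finset.subset_biUnion_of_mem t hi)

theorem biUnion_inter_of_notMem (h : IsTableau τ Λ t) {s : Finset (Fin n)} {i : Fin n}
    (hi : i ∉ s) : s.biUnion t ∩ t i = ∅ := by
  rw [← Finset.disjoint_iff_inter_eq_empty, Finset.disjoint_biUnion_left]
  exact fun j hj => h.disjoint fun hc => hi (hc ▸ hj)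

theorem weight_eq_sum (h : IsTableau τ Λ t) (p : ℤ → ℚ) {J : Finset Node} (hJ : J ⊆ τ) :
    weight p J = ∑ i, weight p (J ∩ t i) := by
  unfold weight
  rw [← Finset.sum_biUnion]
  · congr 1
    ext u
    simp only [Finset.mem_biUnion, Finset.mem_univ, true_and, Finset.mem_inter]
    exact ⟨fun hu => (h.exists_mem (hJ hu)).imp fun i hi => ⟨hu, hi⟩, fun ⟨i, hi⟩ => hi.1⟩
  · intro i _ j _ hij
    exact (h.disjoint hij).mono Finset.inter_subset_right Finset.inter_subset_right

theorem empty : IsTableau ∅ ∅ (Fin.elim0 : Fin 0 → Finset Node) where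
  tiling := ⟨by simp, by simp, by simp, by simp⟩
  injective := fun i => i.elim0
  range_eq := by simp
  order := fun i => i.elim0

theorem cons {T : Finset Node} (hτ : IsSkewShape τ) (hT : Low (· ≤ ·) T τ) (hne : T.Nonempty)
    (h : IsTableau (τ \ T) Λ t) :
    IsTableau τ (insert T Λ) (Fin.cons T t : Fin (n + 1) → Finset Node) := by
  have hd : ∀ i, Disjoint T (t i) := fun i =>
    Finset.disjoint_of_subset_right (h.subset i) Finset.disjoint_sdiff
  have hd' : ∀ μ ∈ Λ, Disjoint T μ := fun μ hμ => by
    obtain ⟨i, rfl⟩ := h.exists_eq hμ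
    exact hd i
  have hTi : ∀ i, T ≠ t i := fun i hc => by
    have := hd i
    rw [← hc, disjoint_self] at this
    exact hne.ne_empty this
  refine ⟨⟨?_, ?_, ?_, ?_⟩, ?_, ?_, ?_⟩
  · exact Finset.forall_mem_insert _ _ _ |>.2 ⟨hne, h.tiling.nonempty⟩
  · exact Finset.forall_mem_insert _ _ _ |>.2 ⟨hT.isSkewShape (Or.inl rfl) hτ, h.tiling.skew⟩
  · intro μ hμ ν hν hμν
    rcases Finset.mem_insert.1 hμ with rfl | hμ' <;> rcases Finset.mem_insert.1 hν with rfl | hν'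
    · exact absurd rfl hμν
    · exact hd' ν hν'
    · exact (hd' μ hμ').symm
    · exact h.tiling.disjoint μ hμ' ν hν' hμν
  · rw [Finset.biUnion_insert, h.tiling.union]
    exact Finset.union_sdiff_of_subset hT.1
  · rw [Fin.cons_injective_iff]
    exact ⟨fun ⟨i, hi⟩ => hTi i hi.symm, h.injective⟩
  · rw [Fin.range_cons, h.range_eq, Finset.coe_insert]
  · intro i j u hu v hv huv
    induction i using Fin.cases with
    | zero => exact Fin.zero_le _
    | succ i =>
      rw [Fin.cons_succ] at hu
      induction j using Fin.cases with
      | zero =>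
        rw [Fin.cons_zero] at hv
        have hu' := Finset.mem_sdiff.1 (h.subset i hu)
        exact absurd (hT.2 v hv u hu'.1 huv) hu'.2
      | succ j =>
        rw [Fin.cons_succ] at hv
        exact Fin.succ_le_succ_iff.2 (h.order i j u hu v hv huv)

end IsTableau

/-- Greedy recursion. It is enough to compare a tile with ideals of the remainder: the next tile is
one of these, and transitivity handles the later ones. -/
theorem exists_tableau {K : PosRoot e → Finset Node → Prop} {rel : PosRoot e → PosRoot e → Prop}
    (htrans : ∀ {a b c}, rel a b → rel b c → rel a c)
    (step : ∀ τ, IsSkewShape τ → τ.Nonempty → ∃ β T, Low (· ≤ ·) T τ ∧ T.Nonempty ∧ K β T ∧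
      ∀ β' T', Low (· ≤ ·) T' (τ \ T) → K β' T' → rel β β')
    {τ : Finset Node} (hτ : IsSkewShape τ) :
    ∃ (Λ : Finset (Finset Node)) (n : ℕ) (t : Fin n → Finset Node) (β : Fin n → PosRoot e),
      IsTableau τ Λ t ∧ (∀ i, K (β i) (t i)) ∧ ∀ i j, i < j → rel (β i) (β j) := by
  induction τ using Finset.strongInduction with
  | H τ ih =>
  rcases τ.eq_empty_or_nonempty with rfl | hne
  · exact ⟨∅, 0, Fin.elim0, Fin.elim0, IsTableau.empty, fun i => i.elim0, fun i => i.elim0⟩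
  obtain ⟨β, T, hT, hTne, hK, hrel⟩ := step τ hτ hne
  have hs : Low (· ≥ ·) (τ \ T) τ := hT.sdiff
  obtain ⟨Λ, n, t, b, ht, hKt, hb⟩ :=
    ih (τ \ T) (Finset.sdiff_ssubset hT.1 hTne) (hs.isSkewShape (Or.inr rfl) hτ)
  refine ⟨insert T Λ, n + 1, Fin.cons T t, Fin.cons β b, ht.cons hτ hT hTne, ?_, ?_⟩
  · exact Fin.cases hK hKt
  · intro i j hij
    induction j using Fin.cases with
    | zero => exact absurd hij (Fin.not_lt_zero i)
    | succ j =>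
      rw [Fin.cons_succ]
      induction i using Fin.cases with
      | zero =>
        rw [Fin.cons_zero]
        let z : Fin n := ⟨0, j.pos⟩
        have hz : ∀ k, z ≤ k := fun k => Fin.le_def.2 (Nat.zero_le _)
        have hlow : Low (· ≤ ·) (t z) (τ \ T) := by
          have := ht.low_biUnion (s := {z}) fun i hi j hji => by
            rw [Finset.mem_singleton] at *
            exact le_antisymm (hi ▸ hji) (hz j)
          rwa [Finset.singleton_biUnion] at this
        have h0 := hrel _ _ hlow (hKt z)
        rcases (hz j).eq_or_lt with h1 | h1
        · exact h1 ▸ h0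
        · exact htrans h0 (hb _ _ h1)
      | succ i =>
        rw [Fin.cons_succ]
        exact hb i j (Fin.succ_lt_succ_iff.1 hij)

/-! ### Existence -/

theorem ConvexPreorder.exists_max (P : ConvexPreorder e) {ι : Type*} {s : Finset ι}
    (hs : s.Nonempty) (f : ι → PosRoot e) : ∃ a ∈ s, ∀ b ∈ s, P.ge (f a) (f b) := by
  induction hs using Finset.Nonempty.cons_induction with
  | singleton a => exact ⟨a, by simp, by simp [P.refl]⟩
  | cons a s ha hs ih =>
    obtain ⟨b, hb, hmax⟩ := ih
    rcases P.total (f a) (f b) with h | h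
    · refine ⟨a, by simp, fun c hc => ?_⟩
      rcases Finset.mem_cons.1 hc with rfl | hc
      · exact P.refl _
      · exact P.trans _ _ _ h (hmax c hc)
    · refine ⟨b, by simp [hb], fun c hc => ?_⟩
      rcases Finset.mem_cons.1 hc with rfl | hc
      · exact h
      · exact hmax c hc

open scoped Classical in
-- Take the greatest content of a ribbon ideal. An ideal of positive weight would contain a ribbon
-- ideal with a strictly greater root.
theorem exists_root_wt_nonpos (P : ConvexPreorder e) {τ : Finset Node} (hτ : IsSkewShape τ)
    (hne : τ.Nonempty) : ∃ β : PosRoot e, (∀ I, Low (· ≤ ·) I τ → P.wt β I ≤ 0) ∧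
      ∃ I, Low (· ≤ ·) I τ ∧ I.Nonempty ∧ P.wt β I = 0 := by
  -- The default `arc e 0 1` plays no role, as only ribbons are compared.
  let f : Finset Node → PosRoot e := fun I =>
    if h : IsPosRoot (content e I) then ⟨_, h⟩ else arc e 0 1
  have hf : ∀ {I n m}, IsRibbon I n m → f I = arc e n m := by
    intro I n m h
    have h1 : IsPosRoot (content e I) := h.content_eq (e := e) ▸ (arc e n m).2
    exact (dif_pos h1).trans (Subtype.ext h.content_eq)
  let s := τ.powerset.filter fun I => Low (· ≤ ·) I τ ∧ ∃ n m, IsRibbon I n m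
  have hs : ∀ I, I ∈ s ↔ Low (· ≤ ·) I τ ∧ ∃ n m, IsRibbon I n m := by
    intro I
    rw [Finset.mem_filter, Finset.mem_powerset]
    exact ⟨fun h => h.2, fun h => ⟨h.1.1, h⟩⟩
  have hs0 : s.Nonempty := by
    obtain ⟨R, n, m, h1, h2, -⟩ := exists_low_isRibbon (r := (· ≤ ·)) (Or.inl rfl)
      (Q := fun _ => True) (fun _ _ _ _ => trivial) (fun _ => 0) hτ hne trivial
    exact ⟨R, (hs R).2 ⟨h1, n, m, h2⟩⟩
  obtain ⟨I, hI, hmax⟩ := P.exists_max hs0 f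
  obtain ⟨hI, n, m, hR⟩ := (hs I).1 hI
  refine ⟨f I, ?_, I, hI, hR.nonempty, ?_⟩
  · intro J hJ
    by_contra hpos
    have hJ0 : J.Nonempty := by
      rw [Finset.nonempty_iff_ne_empty]
      rintro rfl
      simp at hpos
    obtain ⟨R, n, k, h1, h2, h3, -⟩ := exists_low_isRibbon (Or.inl rfl) pos_sub
      (P.potential (f I)) (hJ.isSkewShape (Or.inl rfl) hτ) hJ0 (not_le.1 hpos)
    rw [h2.weight_eq, P.sub_pos_iff h2.lt] at h3
    have := hmax R ((hs R).2 ⟨h1.trans hJ, n, k, h2⟩)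
    rw [hf h2] at this
    exact h3.2 this
  · rw [P.wt_isRibbon _ hR, hf hR]
    exact ((P.sub_nonpos_iff hR.lt).2 (P.refl _)).antisymm ((P.sub_nonneg_iff hR.lt).2 (P.refl _))

/-- Ideals of the remainder still have β-weight ≤ 0, so for β' ≻ β the shape `T'` would have
negative β'-weight instead of zero. -/
theorem exists_stable_step (P : ConvexPreorder e) {τ : Finset Node} (hτ : IsSkewShape τ)
    (hne : τ.Nonempty) : ∃ β T, Low (· ≤ ·) T τ ∧ T.Nonempty ∧ Stable P β T ∧
      ∀ β' T', Low (· ≤ ·) T' (τ \ T) → Stable P β' T' → P.ge β β' := by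
  obtain ⟨β, hle, I, hI, hI0, hI1⟩ := exists_root_wt_nonpos P hτ hne
  obtain ⟨T, hT, hst⟩ := exists_stable_low hτ hle hI hI0 hI1
  refine ⟨β, T, hT, hst.nonempty, hst, fun β' T' hT' hst' => ?_⟩
  rw [← P.not_gt]
  intro hgt
  have := ConvexPreorder.wt_neg_of_ideals hst'.skew hst'.nonempty
    (fun J hJ => wt_nonpos_sdiff hle hT hst.wt_eq J (hJ.trans hT')) hgt
  exact this.ne hst'.wt_eq

open scoped Classical in
-- Taking `T` of maximal size among the nonempty ideals of weight zero makes every nonempty ideal of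
-- the remainder strictly negative, which excludes β' ⪰ β as well.
theorem exists_semistable_step (P : ConvexPreorder e) {τ : Finset Node} (hτ : IsSkewShape τ)
    (hne : τ.Nonempty) : ∃ β T, Low (· ≤ ·) T τ ∧ T.Nonempty ∧ Semistable P β T ∧
      ∀ β' T', Low (· ≤ ·) T' (τ \ T) → Semistable P β' T' → P.gt β β' := by
  obtain ⟨β, hle, I, hI, hI0, hI1⟩ := exists_root_wt_nonpos P hτ hne
  obtain ⟨T, hT, hmax⟩ := (τ.powerset.filter fun I => Low (· ≤ ·) I τ ∧ I.Nonempty ∧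
    P.wt β I = 0).exists_max_image Finset.card
      ⟨I, Finset.mem_filter.2 ⟨Finset.mem_powerset.2 hI.1, hI, hI0, hI1⟩⟩
  obtain ⟨-, hT, hT0, hT1⟩ := Finset.mem_filter.1 hT
  refine ⟨β, T, hT, hT0, ⟨hT.isSkewShape (Or.inl rfl) hτ, hT0, hT1,
    fun J hJ => hle J (hJ.trans hT)⟩, fun β' T' hT' hst' => ?_⟩
  rw [← P.not_ge]
  intro hge
  have := ConvexPreorder.wt_neg_of_ideals' (β := β) hst'.skew hst'.nonempty (fun J hJ hJ0 => by
    have hJ' := hJ.trans hT'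
    refine (wt_nonpos_sdiff hle hT hT1 J hJ').lt_of_ne fun h0 => ?_
    have hd : Disjoint T J := Finset.disjoint_of_subset_right hJ'.1 Finset.disjoint_sdiff
    have hlow := hT.union_of_sdiff hJ'
    have := hmax (T ∪ J) (Finset.mem_filter.2 ⟨Finset.mem_powerset.2 hlow.1, hlow,
      hT0.mono Finset.subset_union_left, by rw [P.wt_union β hd, hT1, h0, add_zero]⟩)
    rw [Finset.card_union_of_disjoint hd] at this
    have := hJ0.card_pos
    omega) hge
  exact this.ne hst'.wt_eq

theorem exists_isCuspidalKostantTiling (he : 1 < e) (P : ConvexPreorder e) {τ : Finset Node}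
    (hτ : IsSkewShape τ) : ∃ Γ, IsCuspidalKostantTiling P τ Γ := by
  obtain ⟨Γ, n, t, β, ht, hst, hge⟩ :=
    exists_tableau (K := Stable P) (rel := P.ge) (fun h h' => P.trans _ _ _ h h') (fun τ hτ hne => exists_stable_step P hτ hne) hτ
  choose ψ h1 h2 h3 h4 using fun i => (hst i).exists_content_eq he
  refine ⟨Γ, ⟨n, t, fun _ => 1, ψ, ht, fun i => ⟨one_pos, by rw [h2, one_smul]⟩, fun i j hij =>
    P.trans _ _ _ (P.trans _ _ _ (h4 i) (hge i j hij)) (h3 j)⟩, fun μ hμ => ?_⟩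
  obtain ⟨i, rfl⟩ := ht.exists_eq hμ
  exact (hst i).isCuspidal he

theorem exists_isSemicuspidalStrictKostantTiling (he : 1 < e) (P : ConvexPreorder e)
    {τ : Finset Node} (hτ : IsSkewShape τ) : ∃ Λ, IsSemicuspidalStrictKostantTiling P τ Λ := by
  obtain ⟨Λ, n, t, β, ht, hst, hgt⟩ :=
    exists_tableau (K := Semistable P) (rel := P.gt) (fun h h' => P.gt_trans h h')
      (fun τ hτ hne => exists_semistable_step P hτ hne) hτ
  choose m ψ h0 h1 h2 h3 h4 using fun i => (hst i).exists_content_eq he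
  refine ⟨Λ, ⟨n, t, m, ψ, ht, fun i => ⟨h0 i, h2 i⟩, fun i j hij =>
    P.gt_of_gt_of_ge (P.gt_of_ge_of_gt (h4 i) (hgt i j hij)) (h3 j)⟩, fun μ hμ => ?_⟩
  obtain ⟨i, rfl⟩ := ht.exists_eq hμ
  exact (hst i).isSemicuspidal he

/-! ### Ideals of maximal weight -/

/-- A tableau with semistable tiles of weakly decreasing slope. -/
structure SemistableTableau (P : ConvexPreorder e) (τ : Finset Node) (Λ : Finset (Finset Node))
    {n : ℕ} (t : Fin n → Finset Node) (β : Fin n → PosRoot e) : Prop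
    extends IsTableau τ Λ t where
  semistable : ∀ i, Semistable P (β i) (t i)
  ge : ∀ i j, i ≤ j → P.ge (β i) (β j)

/-- `J` has maximal weight with respect to `b` among the ideals of `τ`. -/
def IsMaxIdeal (P : ConvexPreorder e) (b : PosRoot e) (J τ : Finset Node) : Prop :=
  Low (· ≤ ·) J τ ∧ ∀ J', Low (· ≤ ·) J' τ → P.wt b J' ≤ P.wt b J

section Semistable

variable {P : ConvexPreorder e} {β b : PosRoot e} {σ J : Finset Node}

/-- All filters of the omitted part have nonnegative β-weight, so that part has positive `b`-weight.
-/
theorem Semistable.wt_lt_of_gt (h : Semistable P β σ) (hb : P.gt β b) (hJ : Low (· ≤ ·) J σ)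
    (hne : J ≠ σ) : P.wt b J < P.wt b σ := by
  have hs : Low (· ≥ ·) (σ \ J) σ := hJ.sdiff
  have := ConvexPreorder.wt_pos_of_filters (hs.isSkewShape (Or.inr rfl) h.skew)
    (hJ.sdiff_nonempty hne) (fun F hF => h.wt_ge (hF.trans hs)) hb
  rw [P.wt_sdiff b hJ.1] at this
  linarith

theorem Semistable.wt_nonpos_of_ge (h : Semistable P β σ) (hb : P.ge b β)
    (hJ : Low (· ≤ ·) J σ) : P.wt b J ≤ 0 :=
  ConvexPreorder.wt_nonpos_of_ideals (hJ.isSkewShape (Or.inl rfl) h.skew)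
    (fun I hI => h.wt_le I (hI.trans hJ)) hb

theorem Semistable.wt_neg_of_gt (h : Semistable P β σ) (hb : P.gt b β)
    (hJ : Low (· ≤ ·) J σ) (hne : J.Nonempty) : P.wt b J < 0 :=
  ConvexPreorder.wt_neg_of_ideals (hJ.isSkewShape (Or.inl rfl) h.skew) hne
    (fun I hI => h.wt_le I (hI.trans hJ)) hb

end Semistable

namespace SemistableTableau

variable {P : ConvexPreorder e} {τ : Finset Node} {Λ Λ' : Finset (Finset Node)} {n n' : ℕ}
  {t : Fin n → Finset Node} {t' : Fin n' → Finset Node} {β : Fin n → PosRoot e}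
  {β' : Fin n' → PosRoot e} {b : PosRoot e} {J : Finset Node}

open scoped Classical in
theorem wt_inter_le (h : SemistableTableau P τ Λ t β) (b : PosRoot e) (hJ : Low (· ≤ ·) J τ)
    (i : Fin n) : P.wt b (J ∩ t i) ≤ if P.gt (β i) b then P.wt b (t i) else 0 := by
  have hlow := hJ.inter (h.subset i)
  split_ifs with hi
  · by_cases hc : J ∩ t i = t i
    · rw [hc]
    · exact ((h.semistable i).wt_lt_of_gt hi hlow hc).le
  · exact (h.semistable i).wt_nonpos_of_ge (P.not_gt.1 hi) hlow

open scoped Classical in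
theorem wt_biUnion (h : SemistableTableau P τ Λ t β) {s : Finset (Fin n)}
    (h1 : ∀ i, P.gt (β i) b → i ∈ s) (h2 : ∀ i ∈ s, P.ge (β i) b) :
    P.wt b (s.biUnion t) = ∑ i, if P.gt (β i) b then P.wt b (t i) else 0 := by
  rw [ConvexPreorder.wt, h.weight_eq_sum _ (Finset.biUnion_subset.2 fun i _ => h.subset i)]
  refine Finset.sum_congr rfl fun i _ => ?_
  split_ifs with hi
  · rw [IsTableau.biUnion_inter_of_mem (h1 i hi)]
    rfl
  · by_cases his : i ∈ s
    · rw [IsTableau.biUnion_inter_of_mem his]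
      have := ((h.semistable i).congr (h2 i his) (P.not_gt.1 hi)).wt_eq
      exact this
    · rw [h.biUnion_inter_of_notMem his, weight_empty]

/-- An ideal meets each tile in an ideal of that tile, which bounds its weight tile by tile. An
initial union attains every bound, and tiles equivalent to `b` contribute zero whether included or
not. -/
theorem isMaxIdeal_biUnion (h : SemistableTableau P τ Λ t β) {s : Finset (Fin n)}
    (hs : ∀ i ∈ s, ∀ j ≤ i, j ∈ s)
    (h1 : ∀ i, P.gt (β i) b → i ∈ s) (h2 : ∀ i ∈ s, P.ge (β i) b) :
    IsMaxIdeal P b (s.biUnion t) τ := by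
  classical
  refine ⟨h.low_biUnion hs, fun J hJ => ?_⟩
  rw [h.wt_biUnion h1 h2, ConvexPreorder.wt, h.weight_eq_sum _ hJ.1]
  exact Finset.sum_le_sum fun i _ => h.wt_inter_le b hJ i

open scoped Classical in
-- A maximal ideal attains the sum of the tilewise bounds, hence each of them.
theorem wt_inter_eq (h : SemistableTableau P τ Λ t β) (hJ : IsMaxIdeal P b J τ) (i : Fin n) :
    P.wt b (J ∩ t i) = if P.gt (β i) b then P.wt b (t i) else 0 := by
  have h1 := hJ.2 _ (h.low_biUnion (s := Finset.univ.filter fun i => P.gt (β i) b) ?_)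
  · rw [h.wt_biUnion (by simp) (fun i hi => (Finset.mem_filter.1 hi).2.1),
      ConvexPreorder.wt, h.weight_eq_sum _ hJ.1.1] at h1
    have h2 := Finset.sum_le_sum fun i (_ : i ∈ Finset.univ) => h.wt_inter_le b hJ.1 i
    exact (Finset.sum_eq_sum_iff_of_le fun i _ => h.wt_inter_le b hJ.1 i).1 (h2.antisymm h1) i
      (Finset.mem_univ i)
  · intro i hi j hji
    simp only [Finset.mem_filter, Finset.mem_univ, true_and] at *
    exact P.gt_of_ge_of_gt (h.ge j i hji) hi

theorem subset_of_gt (h : SemistableTableau P τ Λ t β) (hJ : IsMaxIdeal P b J τ) {i : Fin n}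
    (hi : P.gt (β i) b) : J ∩ t i = t i := by
  by_contra hc
  have h1 := (h.semistable i).wt_lt_of_gt hi (hJ.1.inter (h.subset i)) hc
  rw [h.wt_inter_eq hJ i, if_pos hi] at h1
  exact h1.false

theorem inter_eq_empty_of_gt (h : SemistableTableau P τ Λ t β) (hJ : IsMaxIdeal P b J τ)
    {i : Fin n} (hi : P.gt b (β i)) : J ∩ t i = ∅ := by
  by_contra hc
  have h1 := (h.semistable i).wt_neg_of_gt hi (hJ.1.inter (h.subset i))
    (Finset.nonempty_iff_ne_empty.2 hc)
  rw [h.wt_inter_eq hJ i, if_neg (P.not_gt.2 hi.1)] at h1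
  exact h1.false

/-- The right-hand side mentions only `τ`, which makes the slope at a node intrinsic. -/
theorem ge_iff (h : SemistableTableau P τ Λ t β) {i : Fin n} {u : Node} (hu : u ∈ t i) :
    P.ge (β i) b ↔ ∃ J, IsMaxIdeal P b J τ ∧ u ∈ J := by
  classical
  constructor
  · intro hi
    refine ⟨_, h.isMaxIdeal_biUnion (b := b) (s := Finset.univ.filter fun i => P.ge (β i) b)
      ?_ ?_ ?_, Finset.mem_biUnion.2 ⟨i, by simp [hi], hu⟩⟩
    · intro i hi j hji
      simp only [Finset.mem_filter, Finset.mem_univ, true_and] at *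
      exact P.trans _ _ _ (h.ge j i hji) hi
    · simp +contextual [ConvexPreorder.gt]
    · simp
  · rintro ⟨J, hJ, huJ⟩
    rw [← P.not_gt]
    intro hc
    have := h.inter_eq_empty_of_gt hJ hc
    exact Finset.notMem_empty u (this ▸ Finset.mem_inter.2 ⟨huJ, hu⟩)

/-- The slope of the tile at a node does not depend on the tableau. -/
theorem ge_of_mem (h : SemistableTableau P τ Λ t β) (h' : SemistableTableau P τ Λ' t' β')
    {i : Fin n} {j : Fin n'} {u : Node} (hu : u ∈ t i) (hu' : u ∈ t' j) : P.ge (β i) (β' j) :=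
  (h.ge_iff hu).2 ((h'.ge_iff hu').1 (P.refl _))

theorem isMaxIdeal_Iic (h : SemistableTableau P τ Λ t β) (j : Fin n) :
    IsMaxIdeal P (β j) ((Finset.Iic j).biUnion t) τ := by
  refine h.isMaxIdeal_biUnion ?_ ?_ ?_
  · intro i hi k hk
    rw [Finset.mem_Iic] at *
    exact hk.trans hi
  · intro i hi
    rw [Finset.mem_Iic]
    by_contra hc
    exact hi.2 (h.ge j i (not_le.1 hc).le)
  · intro i hi
    exact h.ge i j (Finset.mem_Iic.1 hi)

/-- For a tile of slope equivalent to `b` the intersection is an ideal of weight zero, and a stable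
tile has no proper nonempty one. -/
theorem inter_eq (h : SemistableTableau P τ Λ t β) (hst : ∀ i, Stable P (β i) (t i))
    (hJ : IsMaxIdeal P b J τ) (i : Fin n) : J ∩ t i = ∅ ∨ J ∩ t i = t i := by
  by_cases h1 : P.gt (β i) b
  · exact Or.inr (h.subset_of_gt hJ h1)
  by_cases h2 : P.gt b (β i)
  · exact Or.inl (h.inter_eq_empty_of_gt hJ h2)
  have h3 := h.wt_inter_eq hJ i
  rw [if_neg h1] at h3
  by_contra hc
  rw [not_or, ← ne_eq, ← Finset.nonempty_iff_ne_empty] at hc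
  have h4 := ((hst i).congr (P.not_gt.1 h2) (P.not_gt.1 h1)).wt_lt _
    (hJ.1.inter (h.subset i)) hc.1 hc.2
  exact h4.ne h3

theorem mem_of_mem (h : SemistableTableau P τ Λ t β) (hst : ∀ i, Stable P (β i) (t i))
    (hJ : IsMaxIdeal P b J τ) {i : Fin n} {u v : Node} (hu : u ∈ t i) (hv : v ∈ t i)
    (huJ : u ∈ J) : v ∈ J := by
  rcases h.inter_eq hst hJ i with h1 | h1
  · exact absurd (h1 ▸ Finset.mem_inter.2 ⟨huJ, hu⟩) (Finset.notMem_empty u)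
  · rw [← h1] at hv
    exact (Finset.mem_inter.1 hv).1

/-- The initial unions of the second tableau are maximal ideals for its slopes, so none separates
two nodes of a stable tile. The second tableau need only be semistable. -/
theorem exists_subset (h : SemistableTableau P τ Λ t β) (hst : ∀ i, Stable P (β i) (t i))
    (h' : SemistableTableau P τ Λ' t' β') (i : Fin n) : ∃ j, t i ⊆ t' j := by
  have key : ∀ {u v j k}, u ∈ t i → v ∈ t i → u ∈ t' j → v ∈ t' k → ¬ j < k := by
    intro u v j k hu hv hu' hv' hjk
    have := h.mem_of_mem hst (h'.isMaxIdeal_Iic j) hu hv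
      (Finset.mem_biUnion.2 ⟨j, by simp, hu'⟩)
    obtain ⟨l, hl, hvl⟩ := Finset.mem_biUnion.1 this
    rw [h'.index_eq hvl hv', Finset.mem_Iic] at hl
    exact absurd hjk (not_lt.2 hl)
  obtain ⟨u, hu⟩ := (h.semistable i).nonempty
  obtain ⟨j, hu'⟩ := h'.exists_mem (h.subset i hu)
  refine ⟨j, fun v hv => ?_⟩
  obtain ⟨k, hv'⟩ := h'.exists_mem (h.subset i hv)
  have : j = k := le_antisymm (not_lt.1 (key hv hu hv' hu')) (not_lt.1 (key hu hv hu' hv'))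
  exact this ▸ hv'

theorem subset_of_stable (h : SemistableTableau P τ Λ t β) (hst : ∀ i, Stable P (β i) (t i))
    (h' : SemistableTableau P τ Λ' t' β') (hst' : ∀ i, Stable P (β' i) (t' i)) : Λ ⊆ Λ' := by
  intro μ hμ
  obtain ⟨i, rfl⟩ := h.exists_eq hμ
  obtain ⟨j, hj⟩ := h.exists_subset hst h' i
  obtain ⟨k, hk⟩ := h'.exists_subset hst' h j
  obtain ⟨u, hu⟩ := (h.semistable i).nonempty
  obtain rfl := h.index_eq hu (hk (hj hu))
  rw [hj.antisymm hk]
  exact h'.mem j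

end SemistableTableau

/-! ### From Kostant tilings to semistable tableaux; uniqueness of the cuspidal one -/

theorem IsCuspidalKostantTiling.exists_tableau {P : ConvexPreorder e} {τ : Finset Node}
    {Γ : Finset (Finset Node)} (h : IsCuspidalKostantTiling P τ Γ) :
    ∃ (n : ℕ) (t : Fin n → Finset Node) (β : Fin n → PosRoot e),
      SemistableTableau P τ Γ t β ∧ ∀ i, Stable P (β i) (t i) := by
  obtain ⟨⟨n, t, m, β, ht, hc, hge⟩, hcusp⟩ := h
  have hst : ∀ i, Stable P (β i) (t i) := by
    intro i
    obtain ⟨γ, h1, h2⟩ := (hcusp _ (ht.mem i)).exists_stable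
    -- The Kostant condition and cuspidality each supply a root for the tile; being proportional,
    -- the two are equivalent.
    have h3 : m i • (β i).1 = 1 • γ.1 := by rw [← (hc i).2, h1, one_smul]
    exact h2.congr (P.ge_of_smul_eq_smul one_pos h3.symm)
      (P.ge_of_smul_eq_smul (hc i).1 h3)
  refine ⟨n, t, β, ⟨ht, fun i => (hst i).toSemistable, fun i j hij => ?_⟩, hst⟩
  rcases hij.eq_or_lt with rfl | hij
  · exact P.refl _
  · exact hge i j hij

theorem IsSemicuspidalStrictKostantTiling.exists_tableau {P : ConvexPreorder e} {τ : Finset Node}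
    {Λ : Finset (Finset Node)} (h : IsSemicuspidalStrictKostantTiling P τ Λ) :
    ∃ (n : ℕ) (t : Fin n → Finset Node) (β : Fin n → PosRoot e),
      SemistableTableau P τ Λ t β ∧ ∀ i j, i < j → P.gt (β i) (β j) := by
  obtain ⟨⟨n, t, m, β, ht, hc, hgt⟩, hcusp⟩ := h
  refine ⟨n, t, β, ⟨ht, fun i => ?_, fun i j hij => ?_⟩, hgt⟩
  · obtain ⟨k, γ, h0, h1, h2⟩ := (hcusp _ (ht.mem i)).exists_semistable
    have h3 : m i • (β i).1 = k • γ.1 := by rw [← (hc i).2, h1]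
    exact h2.congr (P.ge_of_smul_eq_smul h0 h3.symm) (P.ge_of_smul_eq_smul (hc i).1 h3)
  · rcases hij.eq_or_lt with rfl | hij
    · exact P.refl _
    · exact (hgt i j hij).1

theorem IsCuspidalKostantTiling.unique {P : ConvexPreorder e} {τ : Finset Node}
    {Γ Γ' : Finset (Finset Node)} (h : IsCuspidalKostantTiling P τ Γ)
    (h' : IsCuspidalKostantTiling P τ Γ') : Γ = Γ' := by
  obtain ⟨n, t, β, ht, hst⟩ := h.exists_tableau
  obtain ⟨n', t', β', ht', hst'⟩ := h'.exists_tableau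
  exact (ht.subset_of_stable hst ht' hst').antisymm (ht'.subset_of_stable hst' ht hst)

/-! ### Kostant partitions -/

section Psi

variable {P : ConvexPreorder e} {β : PosRoot e} {σ : Finset Node}

theorem Semistable.psi_content_eq_iff (he : 1 < e) (h : Semistable P β σ) {ν : PosRoot e}
    (hν : IsIndivisible ν.1) : psi (content e σ) = ν.1 ↔ P.ge β ν ∧ P.ge ν β := by
  obtain ⟨m, ψ, hm, h1, h2, h3, h4⟩ := h.exists_content_eq he
  rw [h2, psi_smul he hm h1]
  constructor
  · intro hc
    obtain rfl := Subtype.ext hc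
    exact ⟨h3, h4⟩
  · rintro ⟨h5, h6⟩
    rw [P.eq_of_isIndivisible he h1 hν (P.trans _ _ _ h4 h5) (P.trans _ _ _ h6 h3)]

theorem Semistable.rootMult_smul_psi (he : 1 < e) (h : Semistable P β σ) :
    0 < rootMult (content e σ) ∧
      content e σ = rootMult (content e σ) • psi (content e σ) := by
  obtain ⟨m, ψ, hm, h1, h2, -⟩ := h.exists_content_eq he
  rw [h2, psi_smul he hm h1, rootMult_smul he hm h1]
  exact ⟨hm, rfl⟩

theorem Stable.psi_content (he : 1 < e) (h : Stable P β σ) : psi (content e σ) = content e σ := by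
  obtain ⟨ψ, h1, h2, -⟩ := h.exists_content_eq he
  have := psi_smul he one_pos h1
  rwa [one_smul, ← h2] at this

end Psi

open scoped Classical in
/-- The union of the tiles whose content is a multiple of `ν`. -/
def isotypicPart (e : ℕ) (Λ : Finset (Finset Node)) (ν : IndivRoot e) : Finset Node :=
  (Λ.filter fun μ => psi (content e μ) = ν.1).biUnion id

namespace SemistableTableau

variable {P : ConvexPreorder e} {τ : Finset Node} {Λ Λ' : Finset (Finset Node)} {n n' : ℕ}
  {t : Fin n → Finset Node} {t' : Fin n' → Finset Node} {β : Fin n → PosRoot e}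
  {β' : Fin n' → PosRoot e}

theorem mem_isotypicPart_iff (h : SemistableTableau P τ Λ t β) (he : 1 < e) (ν : IndivRoot e)
    {u : Node} {i : Fin n} (hu : u ∈ t i) : u ∈ isotypicPart e Λ ν ↔
      P.ge (β i) ⟨ν.1, ν.2.1⟩ ∧ P.ge ⟨ν.1, ν.2.1⟩ (β i) := by
  rw [← (h.semistable i).psi_content_eq_iff he (ν := ⟨ν.1, ν.2.1⟩) ν.2, isotypicPart,
    Finset.mem_biUnion]
  constructor
  · rintro ⟨μ, hμ, huμ⟩
    obtain ⟨hμ, hψ⟩ := Finset.mem_filter.1 hμ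
    obtain ⟨j, rfl⟩ := h.exists_eq hμ
    rwa [h.index_eq hu huμ]
  · exact fun hi => ⟨t i, Finset.mem_filter.2 ⟨h.mem i, hi⟩, hu⟩

/-- Membership of a node depends only on the slope there, which all tableaux share. -/
theorem isotypicPart_subset (h : SemistableTableau P τ Λ t β)
    (h' : SemistableTableau P τ Λ' t' β') (he : 1 < e) (ν : IndivRoot e) :
    isotypicPart e Λ ν ⊆ isotypicPart e Λ' ν := by
  intro u hu
  have hτ : u ∈ τ := by
    obtain ⟨μ, hμ, huμ⟩ := Finset.mem_biUnion.1 hu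
    obtain ⟨j, rfl⟩ := h.exists_eq (Finset.mem_filter.1 hμ).1
    exact h.subset j huμ
  obtain ⟨i, hi⟩ := h.exists_mem hτ
  obtain ⟨j, hj⟩ := h'.exists_mem hτ
  rw [h.mem_isotypicPart_iff he ν hi] at hu
  rw [h'.mem_isotypicPart_iff he ν hj]
  exact ⟨P.trans _ _ _ (h'.ge_of_mem h hj hi) hu.1, P.trans _ _ _ hu.2 (h.ge_of_mem h' hi hj)⟩

theorem isotypicPart_eq (h : SemistableTableau P τ Λ t β)
    (h' : SemistableTableau P τ Λ' t' β') (he : 1 < e) (ν : IndivRoot e) :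
    isotypicPart e Λ ν = isotypicPart e Λ' ν :=
  (h.isotypicPart_subset h' he ν).antisymm (h'.isotypicPart_subset h he ν)

theorem content_isotypicPart (h : SemistableTableau P τ Λ t β) (he : 1 < e) (ν : IndivRoot e) :
    content e (isotypicPart e Λ ν) = kostantPartition e Λ ν • ν.1 := by
  rw [kostantPartition, Finset.sum_smul, content, isotypicPart, Finset.sum_biUnion]
  · refine Finset.sum_congr rfl fun μ hμ => ?_
    obtain ⟨hμ, hψ⟩ := Finset.mem_filter.1 hμ
    obtain ⟨j, rfl⟩ := h.exists_eq hμ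
    have := ((h.semistable j).rootMult_smul_psi he).2
    rw [hψ] at this
    exact this
  · intro μ hμ ν hν hμν
    exact h.tiling.disjoint μ (Finset.mem_filter.1 hμ).1 ν (Finset.mem_filter.1 hν).1 hμν

/-- Both values are recovered from the height of the content of one common set of nodes. -/
theorem kostantPartition_eq (h : SemistableTableau P τ Λ t β)
    (h' : SemistableTableau P τ Λ' t' β') (he : 1 < e) :
    kostantPartition e Λ = kostantPartition e Λ' := by
  funext ν
  have h1 := h.content_isotypicPart he ν
  rw [h.isotypicPart_eq h' he ν, h'.content_isotypicPart he ν] at h1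
  have h2 := congrArg height h1
  rw [height_smul, height_smul] at h2
  exact (Nat.eq_of_mul_eq_mul_right (height_pos ν.2.1) h2).symm

/-- Strictly decreasing slopes leave at most one tile in each equivalence class. -/
theorem isotypicPart_eq_tile (h : SemistableTableau P τ Λ t β) (he : 1 < e)
    (hgt : ∀ i j, i < j → P.gt (β i) (β j)) {ν : IndivRoot e} {i : Fin n}
    (hi : psi (content e (t i)) = ν.1) : isotypicPart e Λ ν = t i := by
  have hclass : ∀ {j}, psi (content e (t j)) = ν.1 → P.ge (β j) ⟨ν.1, ν.2.1⟩ ∧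
      P.ge ⟨ν.1, ν.2.1⟩ (β j) := fun {j} hj =>
    ((h.semistable j).psi_content_eq_iff he (ν := ⟨ν.1, ν.2.1⟩) ν.2).1 hj
  have hfil : (Λ.filter fun μ => psi (content e μ) = ν.1) = {t i} := by
    ext μ
    rw [Finset.mem_filter, Finset.mem_singleton]
    constructor
    · rintro ⟨hμ, hψ⟩
      obtain ⟨j, rfl⟩ := h.exists_eq hμ
      have h1 := P.trans _ _ _ (hclass hi).1 (hclass hψ).2
      have h2 := P.trans _ _ _ (hclass hψ).1 (hclass hi).2
      rcases lt_trichotomy i j with hlt | rfl | hlt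
      · exact absurd h2 (hgt i j hlt).2
      · rfl
      · exact absurd h1 (hgt j i hlt).2
    · rintro rfl
      exact ⟨h.mem i, hi⟩
  rw [isotypicPart]
  simp only [hfil, Finset.singleton_biUnion, id]

theorem exists_tile_of_kostantPartition_pos (h : SemistableTableau P τ Λ t β) {ν : IndivRoot e}
    (hν : 0 < kostantPartition e Λ ν) : ∃ i, psi (content e (t i)) = ν.1 := by
  by_contra hc
  push Not at hc
  rw [kostantPartition, Finset.filter_eq_empty_iff.2, Finset.sum_empty] at hν
  · exact hν.false
  · intro μ hμ
    obtain ⟨j, rfl⟩ := h.exists_eq hμ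
    exact hc j

theorem kostantPartition_pos (h : SemistableTableau P τ Λ t β) (he : 1 < e) {ν : IndivRoot e}
    {i : Fin n} (hi : psi (content e (t i)) = ν.1) : 0 < kostantPartition e Λ ν := by
  refine lt_of_lt_of_le ((h.semistable i).rootMult_smul_psi he).1 ?_
  exact Finset.single_le_sum (f := fun μ => rootMult (content e μ)) (fun _ _ => Nat.zero_le _)
    (Finset.mem_filter.2 ⟨h.mem i, hi⟩)

end SemistableTableau

/-! ### Merging the cuspidal tiles -/

theorem IsSemicuspidalStrictKostantTiling.eq_mergedTiles (he : 1 < e) {P : ConvexPreorder e}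
    {τ : Finset Node} {Γ Λ : Finset (Finset Node)}
    (hΛ : IsSemicuspidalStrictKostantTiling P τ Λ) (hΓ : IsCuspidalKostantTiling P τ Γ) :
    (Λ : Set (Finset Node)) = mergedTiles e Γ ∧
      kostantPartition e Λ = kostantPartition e Γ := by
  obtain ⟨n, t, β, ht, hst⟩ := hΓ.exists_tableau
  obtain ⟨n', t', β', ht', hgt⟩ := hΛ.exists_tableau
  have hκ := ht'.kostantPartition_eq ht he
  refine ⟨?_, hκ⟩
  have hpart : ∀ ν : IndivRoot e,
      (Γ.filter fun γ => content e γ = ν.1).biUnion id = isotypicPart e Λ ν := by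
    intro ν
    -- A stable tile has indivisible content, so for the tiles of `Γ` having content ν is the same
    -- as having content a multiple of ν.
    rw [ht'.isotypicPart_eq ht he ν, isotypicPart]
    congr 1
    refine Finset.filter_congr fun μ hμ => ?_
    obtain ⟨i, rfl⟩ := ht.exists_eq hμ
    rw [(hst i).psi_content he]
  have hmem : ∀ μ, μ ∈ mergedTiles e Γ ↔
      ∃ ν : IndivRoot e, 0 < kostantPartition e Λ ν ∧ μ = isotypicPart e Λ ν := by
    intro μ
    rw [hκ]
    refine exists_congr fun ν => ?_
    rw [← hpart ν]
  ext μ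
  rw [hmem, Finset.mem_coe]
  constructor
  · intro hμ
    obtain ⟨i, rfl⟩ := ht'.exists_eq hμ
    obtain ⟨m, ψ, hm, h1, h2, -⟩ := (ht'.semistable i).exists_content_eq he
    have hψ : psi (content e (t' i)) = ψ.1 := by rw [h2, psi_smul he hm h1]
    exact ⟨⟨ψ.1, h1⟩, ht'.kostantPartition_pos he hψ, (ht'.isotypicPart_eq_tile he hgt hψ).symm⟩
  · rintro ⟨ν, hν, rfl⟩
    obtain ⟨i, hi⟩ := ht'.exists_tile_of_kostantPartition_pos hν
    rw [ht'.isotypicPart_eq_tile he hgt hi]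
    exact ht'.mem i

end SkewTiling

end

theorem mainTheorem4 (e : ℕ) (he : 1 < e) (P : SkewTiling.ConvexPreorder e)
    (τ : Finset SkewTiling.Node) (hτ : SkewTiling.IsSkewShape τ) (hne : τ.Nonempty) :
    (∃! Γ : Finset (Finset SkewTiling.Node), SkewTiling.IsCuspidalKostantTiling P τ Γ) ∧
    (∃! Λ : Finset (Finset SkewTiling.Node),
      SkewTiling.IsSemicuspidalStrictKostantTiling P τ Λ) ∧
    ∀ Γ Λ : Finset (Finset SkewTiling.Node),
      SkewTiling.IsCuspidalKostantTiling P τ Γ →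
      SkewTiling.IsSemicuspidalStrictKostantTiling P τ Λ →
        (Λ : Set (Finset SkewTiling.Node)) = SkewTiling.mergedTiles e Γ ∧
        SkewTiling.kostantPartition e Λ = SkewTiling.kostantPartition e Γ := by
  obtain ⟨Γ, hΓ⟩ := SkewTiling.exists_isCuspidalKostantTiling he P hτ
  obtain ⟨Λ, hΛ⟩ := SkewTiling.exists_isSemicuspidalStrictKostantTiling he P hτ
  refine ⟨⟨Γ, hΓ, fun Γ' h => h.unique hΓ⟩, ⟨Λ, hΛ, fun Λ' h => ?_⟩,
    fun Γ Λ h h' => h'.eq_mergedTiles he h⟩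
  -- Any semicuspidal strict Kostant tiling is determined by `Γ`, whence uniqueness.
  exact Finset.coe_injective ((h.eq_mergedTiles he hΓ).1.trans (hΛ.eq_mergedTiles he hΓ).1.symm)
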